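/- Let $\alpha,d\ge 1$ be integers and $N$ a prime. **Space.** For $a>0$ and $\mathbf h\in\mathbb Z^d$ put $\varphi_{a,d,\mathbf h}(\mathbf x)=\prod_{j=1}^d (2a)^{-1/2}\exp\bigl(2\pi i h_j\frac{x_j+a}{2a}\bigr)$, $\widehat f(\mathbf h)=\int_{[-a,a]^d}f\,\overline{\varphi_{a,d,\mathbf h}}\,d\mathbf x$ and $r_{\alpha,a,d}(\mathbf h)=\prod_{j=1}^d r_{\alpha,a}(h_j)$ with $r_{\alpha,a}(0)=\sqrt{2a}$ and $r_{\alpha,a}(h)=|\pi h/a|^\alpha$ for $h\ne0$. The scaled Korobov space $\mathcal H(K_{\alpha,a,d})$ consists of the functions $f:[-a,a]^d\to\mathbb R$ with absolutely convergent Fourier series $f=\sum_{\mathbf h}\widehat f(\mathbf h)\varphi_{a,d,\mathbf h}$ (at every point) and $\|f\|_K^2=\sum_{\mathbf h}|\widehat f(\mathbf h)|^2r_{\alpha,a,d}(\mathbf h)^2<\infty$; its inner product is $\langle f,g\rangle_K=\sum_{\mathbf h}\widehat f(\mathbf h)\overline{\widehat g(\mathbf h)}r_{\alpha,a,d}(\mathbf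 h)^2$ and its kernel is $K_{\alpha,a,d}(\mathbf x,\mathbf y)=\sum_{\mathbf h}r_{\alpha,a,d}(\mathbf h)^{-2}\varphi_{a,d,\mathbf h}(\mathbf x)\overline{\varphi_{a,d,\mathbf h}(\mathbf y)}$. **Points.** With $r=r_{\alpha,1/2,d}$ and $\mathbf z\in\{1,\dots,N-1\}^d$, let $$T_{d,s}(z_1,\dots,z_s)=\sum_{\mathbf h\in\mathbb Z^d}\ \sum_{\boldsymbol\ell}\frac{1}{r(\mathbf h)^2\,r(\mathbf h+\boldsymbol\ell)^2},$$ where $\boldsymbol\ell$ runs over the vectors of $\mathbb Z^d$ with $\boldsymbol\ell\cdot\mathbf z\equiv0\pmod N$, $\ell_s\neq0$ and $\ell_j=0$ for $j>s$. The component-by-component (CBC) construction chooses successively, for $s=1,\dots,d$, a component $z^*_s\in\{1,\dots,N-1\}$ that minimises $T_{d,s}(z_1^*,\dots,z_{s-1}^*,\,\cdot\,)$. Such a vector $\mathbf z^*$ exists. For any outcome $\mathbf z^*$ and $a\ge\frac12$ let $X^*=\{\mathbf x_1,\dots,\mathbf x_N\}$ with $\mathbf x_k=2a\{k\mathbf z^*/N\}-(a,\dots,a)$,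 where $\{\cdot\}$ is the componentwise fractional part, let $V_N=\mathrm{span}\{K_{\alpha,a,d}(\mathbf x_k,\cdot):1\le k\le N\}$, and let $P_N$ be the $\mathcal H(K_{\alpha,a,d})$-orthogonal projection onto $V_N$. **Constant.** For $0<\delta<\alpha/2$ let $$C_{\alpha,\delta,d}=\sqrt2\,\max\Bigl\{6,\,2.5+2^{\frac{2\alpha}{\alpha-2\delta}+1}\Bigr\}^{\frac\alpha2-\delta}\Bigl(\sum_{u\subseteq\{1,\dots,d\}}\max(|u|,1)\Bigl[2(2\pi)^{-\frac{\alpha}{\alpha-2\delta}}\zeta\bigl(\tfrac{\alpha}{\alpha-2\delta}\bigr)\Bigr]^{|u|}\Bigr)^{\alpha-2\delta}.$$ **Claim.** For every CBC vector $\mathbf z^*$, every $a\ge\frac12$ and every $\phi\in\mathcal H(K_{\alpha,a,d})$, the projection $P_N\phi$ is the unique element of $V_N$ that agrees with $\phi$ on $X^*$ (the kernel interpolant), and for every $\delta\in(0,\alpha/2)$ $$\|P_N\phi-\phi\|_{L^2([-a,a]^d)}\le C_{\alpha,\delta',d}\,\|\phi\|_K\,(2a)^{\alpha d}\,N^{-(\alpha/2-\delta)},\qquad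 \delta'=\min\{\delta,\tfrac\alpha2-\tfrac14\}.$$ In particular, for $0<\delta\le\frac\alpha2-\frac14$ the constant is $C_{\alpha,\delta,d}$ itself. -/

import Mathlib

noncomputable section

namespace Korobov

open MeasureTheory

/-- The box `[-a,a]^d`, with the Lebesgue measure that it inherits from `ℝ^d`. -/
abbrev Box (a : ℝ) (d : ℕ) : Type :=
  ↥(Set.Icc (fun _ : Fin d => -a) (fun _ : Fin d => a))

instance instMeasureSpaceBox (a : ℝ) (d : ℕ) : MeasureSpace (Box a d) :=
  Measure.Subtype.measureSpace

/-- `φ_{a,h}(x) = (2a)^{-1/2} exp(2πi h (x+a)/(2a))`. -/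
def trig (a : ℝ) (h : ℤ) (x : ℝ) : ℂ :=
  ((1 / Real.sqrt (2 * a) : ℝ) : ℂ) *
    Complex.exp (((2 * Real.pi * h * ((x + a) / (2 * a)) : ℝ) : ℂ) * Complex.I)

/-- `φ_{a,d,h}(x) = ∏_j φ_{a,h_j}(x_j)`. -/
def trigProd {d : ℕ} (a : ℝ) (h : Fin d → ℤ) (x : Box a d) : ℂ :=
  ∏ j, trig a (h j) (x.1 j)

/-- The Fourier coefficient `∫_{[-a,a]^d} f(x) conj(φ_{a,d,h}(x)) dx`. -/
def coeff {d : ℕ} {a : ℝ} (f : Box a d → ℝ) (h : Fin d → ℤ) : ℂ :=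
  ∫ x : Box a d, (f x : ℂ) * (starRingEnd ℂ) (trigProd a h x)

/-- `r_{α,a}(0) = √(2a)` and `r_{α,a}(h) = |πh/a|^α` for `h ≠ 0`. -/
def weight₁ (α : ℕ) (a : ℝ) (h : ℤ) : ℝ :=
  if h = 0 then Real.sqrt (2 * a) else |Real.pi * h / a| ^ α

/-- `r_{α,a,d}(h) = ∏_j r_{α,a}(h_j)`. For `a = 1/2` these are the weights of the unscaled
space on the unit cube: `1` for `h_j = 0` and `|2πh_j|^α` otherwise. -/
def weight {d : ℕ} (α : ℕ) (a : ℝ) (h : Fin d → ℤ) : ℝ :=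
  ∏ j, weight₁ α a (h j)

lemma norm_trigProd {d : ℕ} (a : ℝ) (h : Fin d → ℤ) (x : Box a d) :
    ‖trigProd a h x‖ = (1 / Real.sqrt (2 * a)) ^ d := by
  have h1 : ∀ j, ‖trig a (h j) (x.1 j)‖ = 1 / Real.sqrt (2 * a) := by
    intro j
    rw [trig, norm_mul, Complex.norm_exp_ofReal_mul_I, mul_one, Complex.norm_real,
      Real.norm_of_nonneg (by positivity)]
  simp [trigProd, norm_prod, h1]

lemma continuous_trigProd {d : ℕ} (a : ℝ) (h : Fin d → ℤ) :
    Continuous (trigProd (d := d) a h) := by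
  unfold trigProd trig
  refine continuous_finsetProd _ fun j _ => ?_
  have hj : Continuous fun x : Box a d => x.1 j := (continuous_apply j).comp continuous_subtype_val
  have h2 : Continuous fun x : Box a d => 2 * Real.pi * (h j : ℝ) * ((x.1 j + a) / (2 * a)) :=
    continuous_const.mul ((hj.add continuous_const).div_const _)
  exact continuous_const.mul (Complex.continuous_exp.comp
    ((Complex.continuous_ofReal.comp h2).mul continuous_const))

instance instIsFiniteMeasureBox (a : ℝ) (d : ℕ) :
    IsFiniteMeasure (volume : Measure (Box a d)) := by
  refine ⟨?_⟩
  rw [Measure.Subtype.volume_univ measurableSet_Icc.nullMeasurableSet]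
  exact isCompact_Icc.measure_lt_top

/-- Pointwise unconditional (that is, absolute) convergence of the Fourier series of `f` to `f`. -/
def HasFourierSeries {d : ℕ} {a : ℝ} (f : Box a d → ℝ) : Prop :=
  ∀ x, HasSum (fun h => coeff f h * trigProd a h x) (f x : ℂ)

lemma HasFourierSeries.continuous {d : ℕ} {a : ℝ} {f : Box a d → ℝ}
    (hf : HasFourierSeries f) : Continuous f := by
  rcases isEmpty_or_nonempty (Box a d) with hE | ⟨⟨x₀⟩⟩
  · exact continuous_of_const fun x => (hE.false x).elim
  have hs : Summable fun h => ‖coeff f h‖ * (1 / Real.sqrt (2 * a)) ^ d := by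
    have := (hf x₀).summable.norm
    simpa [norm_mul, norm_trigProd] using this
  have hc : Continuous fun x => ∑' h, coeff f h * trigProd a h x := by
    refine continuous_tsum (fun h => (continuous_const.mul (continuous_trigProd a h))) hs ?_
    intro h x
    rw [norm_mul, norm_trigProd]
  have : f = fun x => (∑' h, coeff f h * trigProd a h x).re := by
    funext x
    rw [(hf x).tsum_eq, Complex.ofReal_re]
  rw [this]
  exact Complex.continuous_re.comp hc

lemma integrable_coeff {d : ℕ} {a : ℝ} {f : Box a d → ℝ} (hf : Continuous f)
    (h : Fin d → ℤ) :
    Integrable fun x : Box a d => (f x : ℂ) * (starRingEnd ℂ) (trigProd a h x) := by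
  have hc : Continuous fun x : Box a d => (f x : ℂ) * (starRingEnd ℂ) (trigProd a h x) :=
    (Complex.continuous_ofReal.comp hf).mul
      (Complex.continuous_conj.comp (continuous_trigProd a h))
  obtain ⟨C, hC⟩ := (isCompact_univ.image hc).isBounded.exists_norm_le
  exact Integrable.of_bound hc.aestronglyMeasurable C
    (Filter.Eventually.of_forall fun x => hC _ ⟨x, trivial, rfl⟩)

lemma coeff_add {d : ℕ} {a : ℝ} {f g : Box a d → ℝ} (hf : Continuous f) (hg : Continuous g)
    (h : Fin d → ℤ) : coeff (f + g) h = coeff f h + coeff g h := by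
  unfold coeff
  rw [← integral_add (integrable_coeff hf h) (integrable_coeff hg h)]
  simp [add_mul]

lemma coeff_smul {d : ℕ} {a : ℝ} (c : ℝ) (f : Box a d → ℝ) (h : Fin d → ℤ) :
    coeff (c • f) h = c * coeff f h := by
  unfold coeff
  rw [← integral_const_mul]
  simp [mul_assoc]

/-- The functions `f : [-a,a]^d → ℝ` with an absolutely convergent Fourier series and
`∑_h |f̂(h)|² r_{α,a,d}(h)² < ∞`. -/
def korobovSubmodule (α : ℕ) (a : ℝ) (d : ℕ) : Submodule ℝ (Box a d → ℝ) where
  carrier := {f | HasFourierSeries f ∧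
    Summable fun h : Fin d → ℤ => ‖coeff f h‖ ^ 2 * weight α a h ^ 2}
  zero_mem' := by
    have h0 : ∀ h, coeff (0 : Box a d → ℝ) h = 0 := fun h => by simp [coeff]
    refine ⟨fun x => ?_, ?_⟩
    · simp [h0]
    · simp [h0]
  add_mem' := by
    rintro f g ⟨hf, hf2⟩ ⟨hg, hg2⟩
    have hadd := coeff_add hf.continuous hg.continuous
    refine ⟨fun x => ?_, ?_⟩
    · simpa [hadd, add_mul] using (hf x).add (hg x)
    · refine Summable.of_nonneg_of_le (fun h => by positivity) (fun h => ?_)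
        ((hf2.add hg2).mul_left 2)
      rw [hadd]
      have h1 := norm_add_le (coeff f h) (coeff g h)
      have h2 : ‖coeff f h + coeff g h‖ ^ 2 ≤ 2 * (‖coeff f h‖ ^ 2 + ‖coeff g h‖ ^ 2) := by
        nlinarith [norm_nonneg (coeff f h + coeff g h), sq_nonneg (‖coeff f h‖ - ‖coeff g h‖)]
      nlinarith [mul_le_mul_of_nonneg_right h2 (sq_nonneg (weight α a h))]
  smul_mem' := by
    rintro c f ⟨hf, hf2⟩
    refine ⟨fun x => ?_, ?_⟩
    · simpa [coeff_smul, mul_assoc] using (hf x).mul_left (c : ℂ)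
    · simpa [coeff_smul, mul_pow, mul_assoc] using hf2.mul_left (c ^ 2)

/-- The scaled Korobov space `H(K_{α,a,d})`. It is kept apart from the subtype of
`korobovSubmodule`, whose topology would be that of pointwise convergence. -/
def KorobovSpace (α : ℕ) (a : ℝ) (d : ℕ) : Type := ↥(korobovSubmodule α a d)

instance instAddCommGroup (α : ℕ) (a : ℝ) (d : ℕ) : AddCommGroup (KorobovSpace α a d) :=
  inferInstanceAs (AddCommGroup ↥(korobovSubmodule α a d))

instance instModule (α : ℕ) (a : ℝ) (d : ℕ) : Module ℝ (KorobovSpace α a d) :=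
  inferInstanceAs (Module ℝ ↥(korobovSubmodule α a d))

/-- Elements of the Korobov space, as functions on the box. -/
def toFun {α : ℕ} {a : ℝ} {d : ℕ} : KorobovSpace α a d →ₗ[ℝ] (Box a d → ℝ) :=
  (korobovSubmodule α a d).subtype

instance instCoeFun (α : ℕ) (a : ℝ) (d : ℕ) :
    CoeFun (KorobovSpace α a d) fun _ => Box a d → ℝ := ⟨fun f => toFun f⟩

lemma toFun_injective {α : ℕ} {a : ℝ} {d : ℕ} :
    Function.Injective (toFun : KorobovSpace α a d →ₗ[ℝ] (Box a d → ℝ)) :=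
  Subtype.val_injective

/-- `⟨f, g⟩ = ∑_h f̂(h) conj(ĝ(h)) r_{α,a,d}(h)²`. The sum is a real number, because `f` and `g`
are real-valued. -/
def innerK {α : ℕ} {a : ℝ} {d : ℕ} (f g : KorobovSpace α a d) : ℝ :=
  (∑' h : Fin d → ℤ, coeff f h * (starRingEnd ℂ) (coeff g h) * ((weight α a h ^ 2 : ℝ) : ℂ)).re

lemma summable_innerK {α : ℕ} {a : ℝ} {d : ℕ} (f g : KorobovSpace α a d) :
    Summable fun h : Fin d → ℤ =>
      coeff f h * (starRingEnd ℂ) (coeff g h) * ((weight α a h ^ 2 : ℝ) : ℂ) := by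
  refine Summable.of_norm_bounded (f.2.2.add g.2.2) (fun h => ?_)
  rw [norm_mul, norm_mul, RCLike.norm_conj, Complex.norm_real, Real.norm_of_nonneg (sq_nonneg _)]
  change ‖coeff f.1 h‖ * ‖coeff g.1 h‖ * weight α a h ^ 2 ≤ _
  have h2 : ‖coeff f.1 h‖ * ‖coeff g.1 h‖ ≤ ‖coeff f.1 h‖ ^ 2 + ‖coeff g.1 h‖ ^ 2 := by
    nlinarith [sq_nonneg (‖coeff f.1 h‖ - ‖coeff g.1 h‖), sq_nonneg (‖coeff f.1 h‖),
      sq_nonneg (‖coeff g.1 h‖)]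
  nlinarith [mul_le_mul_of_nonneg_right h2 (sq_nonneg (weight α a h))]

lemma innerK_self {α : ℕ} {a : ℝ} {d : ℕ} (f : KorobovSpace α a d) :
    innerK f f = ∑' h : Fin d → ℤ, ‖coeff f h‖ ^ 2 * weight α a h ^ 2 := by
  unfold innerK
  rw [← Complex.ofReal_re (∑' h : Fin d → ℤ, ‖coeff f h‖ ^ 2 * weight α a h ^ 2),
    Complex.ofReal_tsum]
  congr 2
  funext h
  rw [Complex.mul_conj, Complex.normSq_eq_norm_sq]
  push_cast
  rfl

lemma weight_ne_zero {d : ℕ} (α : ℕ) {a : ℝ} (h : Fin d → ℤ) (x : Box a d)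
    (hx : trigProd a h x ≠ 0) : weight α a h ≠ 0 := by
  refine Finset.prod_ne_zero_iff.2 fun j _ => ?_
  have hj : trig a (h j) (x.1 j) ≠ 0 := Finset.prod_ne_zero_iff.1 hx j (Finset.mem_univ j)
  have hs : Real.sqrt (2 * a) ≠ 0 := by
    intro hs
    exact hj (by simp [trig, hs])
  unfold weight₁
  split_ifs with h0
  · exact hs
  · have ha : a ≠ 0 := by
      rintro rfl
      simp at hs
    have : (h j : ℝ) ≠ 0 := by exact_mod_cast h0
    have hpi := Real.pi_ne_zero
    positivity

/-- The inner product axioms for `innerK`. -/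
@[reducible]
def core (α : ℕ) (a : ℝ) (d : ℕ) : InnerProductSpace.Core ℝ (KorobovSpace α a d) where
  inner := innerK
  conj_inner_symm f g := by
    simp only [conj_trivial]
    unfold innerK
    rw [← Complex.conj_re, Complex.conj_tsum]
    congr 2
    funext h
    simp [mul_comm]
  re_inner_nonneg f := by
    change 0 ≤ innerK f f
    rw [innerK_self]
    exact tsum_nonneg fun h => by positivity
  add_left f g k := by
    unfold innerK
    rw [← Complex.add_re, ← (summable_innerK f k).tsum_add (summable_innerK g k)]
    congr 2
    funext h
    have hfg : coeff (toFun f + toFun g) h = coeff (toFun f) h + coeff (toFun g) h :=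
      coeff_add f.2.1.continuous g.2.1.continuous h
    rw [map_add, hfg]
    ring
  smul_left f g c := by
    unfold innerK
    rw [conj_trivial, ← Complex.re_ofReal_mul, ← tsum_mul_left]
    congr 2
    funext h
    rw [map_smul, coeff_smul]
    ring
  definite f hf := by
    change innerK f f = 0 at hf
    rw [innerK_self] at hf
    have h0 := (hasSum_zero_iff_of_nonneg (fun h => by positivity)).1 (hf ▸ f.2.2.hasSum)
    refine toFun_injective (funext fun x => ?_)
    have hz : ∀ h, coeff f.1 h * trigProd a h x = 0 := by
      intro h
      by_cases hx : trigProd a h x = 0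
      · rw [hx, mul_zero]
      · have := congrFun h0 h
        simp only [Pi.zero_apply, mul_eq_zero, pow_eq_zero_iff (two_ne_zero), norm_eq_zero] at this
        rcases this with h1 | h1
        · rw [h1, zero_mul]
        · exact absurd h1 (weight_ne_zero α h x hx)
    have hs := f.2.1 x
    simp only [hz] at hs
    exact Complex.ofReal_eq_zero.1 (hs.unique hasSum_zero)

instance instNormedAddCommGroup (α : ℕ) (a : ℝ) (d : ℕ) :
    NormedAddCommGroup (KorobovSpace α a d) :=
  (core α a d).toNormedAddCommGroup

instance instInnerProductSpace (α : ℕ) (a : ℝ) (d : ℕ) :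
    InnerProductSpace ℝ (KorobovSpace α a d) :=
  InnerProductSpace.ofCore (core α a d).toCore

/-- The kernel `K_{α,a,d}(x,y) = ∑_h r_{α,a,d}(h)^{-2} φ_{a,d,h}(x) conj(φ_{a,d,h}(y))`. The sum
is a real number, because the terms at `h` and `-h` are conjugate. -/
def kernel {d : ℕ} (α : ℕ) (a : ℝ) (x y : Box a d) : ℝ :=
  (∑' h : Fin d → ℤ, (((weight α a h ^ 2)⁻¹ : ℝ) : ℂ) * trigProd a h x *
    (starRingEnd ℂ) (trigProd a h y)).re

/-- `V_N(X) = span {K(x_k, ·)}`, as a subspace of the Korobov space. -/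
def kernelSpan {ι : Type*} {d : ℕ} (α : ℕ) {a : ℝ} (X : ι → Box a d) :
    Submodule ℝ (KorobovSpace α a d) :=
  (Submodule.span ℝ (Set.range fun k => kernel α a (X k))).comap toFun

instance instFiniteDimensionalKernelSpan {ι : Type*} [Finite ι] {d : ℕ} (α : ℕ) {a : ℝ}
    (X : ι → Box a d) : FiniteDimensional ℝ (kernelSpan α X) := by
  have : FiniteDimensional ℝ (Submodule.span ℝ (Set.range fun k => kernel α a (X k))) :=
    FiniteDimensional.span_of_finite ℝ (Set.finite_range _)
  let T : kernelSpan α X →ₗ[ℝ] Submodule.span ℝ (Set.range fun k => kernel α a (X k)) :=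
    (toFun.comp (kernelSpan α X).subtype).codRestrict _ fun v => v.2
  refine FiniteDimensional.of_injective T fun u v huv => ?_
  have h : toFun u.1 = toFun v.1 := congrArg (fun w => w.1) huv
  exact Subtype.ext (toFun_injective h)

/-- The `H(K_{α,a,d})`-orthogonal projection `P_N` onto `V_N(X)`. -/
def proj {ι : Type*} [Finite ι] {d : ℕ} (α : ℕ) {a : ℝ} (X : ι → Box a d)
    (φ : KorobovSpace α a d) : KorobovSpace α a d :=
  (kernelSpan α X).starProjection φ

/-- The summand `T_{d,s}(z_1,…,z_s)` of the criterion
`S_d(z) = ∑_{h ∈ ℤ^d} ∑_{0 ≠ ℓ ∈ ℤ^d, ℓ·z ≡ 0 (mod N)} r(h)^{-2} r(h+ℓ)^{-2}`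
(weights of the unit cube) in its dimension-wise decomposition `S_d = ∑_s T_{d,s}`: it collects
the `ℓ` whose last nonzero component is the one with index `s`, hence depends on `z` only through
the components up to `s`. -/
def cbcCriterion {d : ℕ} (α N : ℕ) (s : Fin d) (z : Fin d → ℕ) : ℝ :=
  open Classical in
  ∑' p : (Fin d → ℤ) × (Fin d → ℤ),
    if p.2 s ≠ 0 ∧ (∀ j, s < j → p.2 j = 0) ∧ (N : ℤ) ∣ ∑ j, p.2 j * (z j : ℤ) then
      (weight α (1 / 2) p.1 ^ 2 * weight α (1 / 2) (p.1 + p.2) ^ 2)⁻¹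
    else 0

/-- `z` is an outcome of the component-by-component construction with `N` points: successively for
`s = 1, …, d`, with the earlier components held fixed, `z_s ∈ {1, …, N-1}` is chosen so as to
minimise `T_{d,s}(z_1,…,z_s)`. -/
def IsCBCVector {d : ℕ} (α N : ℕ) (z : Fin d → ℕ) : Prop :=
  ∀ s : Fin d, (1 ≤ z s ∧ z s < N) ∧
    ∀ c : ℕ, 1 ≤ c → c < N → cbcCriterion α N s z ≤ cbcCriterion α N s (Function.update z s c)

/-- The points `J_a({k z / N}) = 2a {k z / N} - a` of the scaled lattice; the index `k : Fin N`
stands for `k + 1 ∈ {1, …, N}`. -/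
def scaledLattice {d : ℕ} (a : ℝ) (ha : 0 ≤ a) (N : ℕ) (z : Fin d → ℕ) (k : Fin N) : Box a d :=
  ⟨fun j => 2 * a * Int.fract ((((k : ℕ) : ℝ) + 1) * (z j : ℝ) / (N : ℝ)) - a, by
    constructor <;> intro j
    · have := mul_nonneg ha (Int.fract_nonneg ((((k : ℕ) : ℝ) + 1) * (z j : ℝ) / (N : ℝ)))
      simp only
      linarith
    · have := mul_le_mul_of_nonneg_left
        (Int.fract_lt_one ((((k : ℕ) : ℝ) + 1) * (z j : ℝ) / (N : ℝ))).le ha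
      simp only
      linarith⟩

/-- `ζ(s) = ∑_{n ≥ 1} n^{-s}` for real `s > 1`. -/
def zeta (s : ℝ) : ℝ := ∑' n : ℕ, ((n : ℝ) + 1) ^ (-s)

/-- `κ_{α,δ} = √2 max{6, 2.5 + 2^{2α/(α-2δ)+1}}^{α/2-δ}`. -/
def kappa (α : ℕ) (δ : ℝ) : ℝ :=
  Real.sqrt 2 *
    (max 6 (5 / 2 + (2 : ℝ) ^ (2 * (α : ℝ) / ((α : ℝ) - 2 * δ) + 1))) ^ ((α : ℝ) / 2 - δ)

/-- `C_{α,δ,d} = κ_{α,δ} (∑_{u ⊆ {1:d}} max(|u|,1)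
[2 (2π)^{-α/(α-2δ)} ζ(α/(α-2δ))]^{|u|})^{α-2δ}`. -/
def errorConst (α : ℕ) (δ : ℝ) (d : ℕ) : ℝ :=
  kappa α δ *
    (∑ u : Finset (Fin d), ((max u.card 1 : ℕ) : ℝ) *
      (2 * (1 / (2 * Real.pi)) ^ ((α : ℝ) / ((α : ℝ) - 2 * δ)) *
        zeta ((α : ℝ) / ((α : ℝ) - 2 * δ))) ^ u.card) ^ ((α : ℝ) - 2 * δ)

end Korobov

end

noncomputable section

namespace Korobov

open MeasureTheory
open scoped ENNReal ComplexConjugate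

/-! ### Sums of nonnegative terms -/

/-! The reproducing property makes V_N^⊥ the space of functions vanishing on the lattice points.
Hence P_Nφ is the kernel interpolant, and the error g = φ − P_Nφ vanishes on X* with ‖g‖_K ≤ ‖φ‖_K.
It remains to bound the L² norm of a function that vanishes on the lattice.

Such a g satisfies ∑_{ℓ·z≡0} ĝ(h+ℓ) = 0 for every h (`hasSum_coeff_dual`). Solving for ĝ(h) and
applying Cauchy-Schwarz gives |ĝ(h)|² ≤ G ∑_{ℓ≠0} r(h+ℓ)^{-2} over the dual lattice, where G =
∑|ĝ|²r² with the unit-cube weights r. In Parseval's sum, the frequencies with r(h)² > M contribute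
at most G/M; for the others 1 ≤ M r(h)^{-2}, so they contribute at most G·M·S, where S is the full
criterion `dualSum`. The choice M = S^{-1/2} would give ‖g‖² ≤ 2√S·G (`integral_sq_le`, with an
upper bound for √S). Moreover G ≤ (2a)^{2αd}‖g‖_K², which is where a ≥ 1/2 enters.

The bound S = O(N^{-1/q}) comes from averaging (`dualSum_rpow_le`). For 0 < q ≤ 1 the power q is
subadditive, so S^q ≤ ∑_s T_s^q, and each minimised T_s^q is at most its mean over the N−1
candidates. If N ∤ ℓ_s, at most one candidate puts ℓ into the dual lattice, which gains 1/(N−1). If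
N ∣ ℓ_s ≠ 0, the decay of the weights gains 1/N. All sums factor over coordinates and converge when
b = 2αq > 1. With 1/q = 2(α−2δ) this yields the claimed rate, and q ≤ 1 means δ ≤ α/2 − 1/4, hence
the cap δ'. -/

lemma tsum_pi_prod {β : Type*} : ∀ {d : ℕ} (F : Fin d → β → ℝ≥0∞),
    ∑' h : Fin d → β, ∏ j, F j (h j) = ∏ j, ∑' b, F j b
  | 0, F => by simp [tsum_fintype]
  | d + 1, F => by
    rw [← (Fin.consEquiv fun _ => β).tsum_eq, ENNReal.tsum_prod', Fin.prod_univ_succ,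
      ← tsum_pi_prod fun j => F j.succ, ← ENNReal.tsum_mul_right]
    refine tsum_congr fun b => ?_
    rw [← ENNReal.tsum_mul_left]
    refine tsum_congr fun h => ?_
    simp [Fin.prod_univ_succ, Fin.consEquiv]

lemma rpow_sum_le_sum_rpow {ι : Type*} (s : Finset ι) (f : ι → ℝ≥0∞) {p : ℝ} (hp : 0 < p)
    (hp1 : p ≤ 1) : (∑ i ∈ s, f i) ^ p ≤ ∑ i ∈ s, f i ^ p := by
  classical
  induction s using Finset.induction_on with
  | empty => simp [hp]
  | insert i s hi ih =>
    rw [Finset.sum_insert hi, Finset.sum_insert hi]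
    exact (ENNReal.rpow_add_le_add_rpow _ _ hp.le hp1).trans (by gcongr)

lemma rpow_tsum_le_tsum_rpow {ι : Type*} (f : ι → ℝ≥0∞) {p : ℝ} (hp : 0 < p) (hp1 : p ≤ 1) :
    (∑' i, f i) ^ p ≤ ∑' i, f i ^ p := by
  -- Moving the power to the right leaves a bare sum on the left, a supremum of finite partial sums.
  rw [← ENNReal.le_rpow_inv_iff hp]
  rw [ENNReal.tsum_eq_iSup_sum]
  refine iSup_le fun s => ?_
  rw [ENNReal.le_rpow_inv_iff hp]
  exact (rpow_sum_le_sum_rpow s f hp hp1).trans (ENNReal.sum_le_tsum s)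

/-! ### One-dimensional weights -/

/-- `1` at `h = 0` and `(2π|h|)^{-b}` elsewhere. -/
def rho (b : ℝ) (h : ℤ) : ℝ := if h = 0 then 1 else (2 * Real.pi * |(h : ℝ)|) ^ (-b)

/-- `2 (2π)^{-b} ζ(b)`, the sum of `rho b` over the nonzero integers. -/
def omega (b : ℝ) : ℝ := 2 * (1 / (2 * Real.pi)) ^ b * zeta b

lemma rho_zero (b : ℝ) : rho b 0 = 1 := by simp [rho]

lemma rho_pos (b : ℝ) (h : ℤ) : 0 < rho b h := by
  unfold rho
  split_ifs with h0
  · exact one_pos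
  · have : (h : ℝ) ≠ 0 := by exact_mod_cast h0
    have := Real.pi_pos
    positivity

lemma rho_neg (b : ℝ) (h : ℤ) : rho b (-h) = rho b h := by simp [rho]

/-- Powers stay within the family: r^{-2} is `rho` at 2α and its q-th power is `rho` at 2αq. One
real parameter b therefore serves every exponent q. -/
lemma rho_rpow (b p : ℝ) (h : ℤ) : rho b h ^ p = rho (b * p) h := by
  unfold rho
  split_ifs with h0
  · simp
  · rw [← Real.rpow_mul (by have := Real.pi_pos; positivity)]
    simp

lemma inv_weight₁_sq (α : ℕ) (h : ℤ) :
    (weight₁ α (1 / 2) h ^ 2)⁻¹ = rho (2 * α) h := by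
  unfold weight₁ rho
  split_ifs with h0
  · simp
  · have hpi := Real.pi_pos
    rw [show Real.pi * h / (1 / 2) = 2 * Real.pi * h by ring, abs_mul,
      abs_of_pos (by positivity : 0 < 2 * Real.pi), Real.rpow_neg (by positivity),
      show (2 * α : ℝ) = ((α * 2 : ℕ) : ℝ) by push_cast; ring, Real.rpow_natCast, pow_mul]

lemma summable_zeta {b : ℝ} (hb : 1 < b) : Summable fun n : ℕ => ((n : ℝ) + 1) ^ (-b) := by
  have := (summable_nat_add_iff 1).2 (Real.summable_nat_rpow.2 (by linarith : -b < -1))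
  simpa using this

lemma zeta_nonneg (b : ℝ) : 0 ≤ zeta b := tsum_nonneg fun n => by positivity

lemma omega_nonneg (b : ℝ) : 0 ≤ omega b := by
  have := zeta_nonneg b
  have := Real.pi_pos
  unfold omega
  positivity

lemma rho_natCast_add_one (b : ℝ) (n : ℕ) :
    rho b ((n : ℤ) + 1) = (1 / (2 * Real.pi)) ^ b * ((n : ℝ) + 1) ^ (-b) := by
  have hpi := Real.pi_pos
  rw [rho, if_neg (by positivity)]
  push_cast
  rw [abs_of_pos (by positivity), Real.mul_rpow (by positivity) (by positivity), one_div,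
    Real.inv_rpow (by positivity), Real.rpow_neg (by positivity) b]

lemma hasSum_rho {b : ℝ} (hb : 1 < b) : HasSum (rho b) (1 + omega b) := by
  have hz : HasSum (fun n : ℕ => rho b ((n : ℤ) + 1)) ((1 / (2 * Real.pi)) ^ b * zeta b) := by
    simp only [rho_natCast_add_one]
    exact (summable_zeta hb).hasSum.mul_left _
  have h1 : HasSum (fun n : ℕ => rho b n) ((1 / (2 * Real.pi)) ^ b * zeta b + 1) := by
    have := (hasSum_nat_add_iff (f := fun n : ℕ => rho b n)
      (g := (1 / (2 * Real.pi)) ^ b * zeta b) 1).1 (by simpa using hz)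
    simpa [rho_zero] using this
  have h2 : HasSum (fun n : ℕ => rho b (-((n : ℤ) + 1))) ((1 / (2 * Real.pi)) ^ b * zeta b) := by
    simpa only [rho_neg] using hz
  convert HasSum.of_nat_of_neg_add_one h1 h2 using 1
  unfold omega
  ring

lemma tsum_rho {b : ℝ} (hb : 1 < b) :
    ∑' h, ENNReal.ofReal (rho b h) = ENNReal.ofReal (1 + omega b) := by
  rw [← (hasSum_rho hb).tsum_eq, ENNReal.ofReal_tsum_of_nonneg (fun h => (rho_pos b h).le)
    (hasSum_rho hb).summable]

lemma tsum_rho_ne_zero {b : ℝ} (hb : 1 < b) :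
    ∑' h, (if h = 0 then 0 else ENNReal.ofReal (rho b h)) = ENNReal.ofReal (omega b) := by
  have h1 := ENNReal.tsum_eq_add_tsum_ite (f := fun h => ENNReal.ofReal (rho b h)) (0 : ℤ)
  rw [tsum_rho hb, ENNReal.ofReal_add one_pos.le (omega_nonneg b), rho_zero] at h1
  convert! ((ENNReal.add_right_inj ENNReal.ofReal_ne_top).1 h1).symm

/-! ### Correlations of the weights -/

lemma rho_le_of_abs_le {b : ℝ} (hb : 0 ≤ b) {h l : ℤ} (hl : l ≠ 0) (hlh : |l| ≤ 2 * |h|) :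
    rho b h ≤ 2 ^ b * rho b l := by
  have hpi := Real.pi_pos
  have h0 : h ≠ 0 := by
    rintro rfl
    simp at hlh
    exact hl hlh
  have hl' : (0 : ℝ) < |(l : ℝ)| := abs_pos.2 (by exact_mod_cast hl)
  have hh : |(l : ℝ)| ≤ 2 * |(h : ℝ)| := by exact_mod_cast hlh
  rw [rho, rho, if_neg h0, if_neg hl]
  calc (2 * Real.pi * |(h : ℝ)|) ^ (-b) ≤ (2⁻¹ * (2 * Real.pi * |(l : ℝ)|)) ^ (-b) := by
        refine Real.rpow_le_rpow_of_nonpos (by positivity) ?_ (by linarith)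
        nlinarith
    _ = 2 ^ b * (2 * Real.pi * |(l : ℝ)|) ^ (-b) := by
        rw [Real.mul_rpow (by positivity) (by positivity), Real.inv_rpow (by positivity),
          Real.rpow_neg (by positivity), inv_inv]

/-- Since h and h+l differ by l, one of them has absolute value at least |l|/2; its factor is at
most 2^b times that of l, and the other factor survives. The two places where a factor equals 1 are
split off, so that only sums over nonzero integers remain. -/
lemma rho_mul_rho_le {b : ℝ} (hb : 0 ≤ b) {l : ℤ} (hl : l ≠ 0) (h : ℤ) :
    rho b h * rho b (h + l) ≤ (if h = 0 then rho b l else 0) + (if h = -l then rho b l else 0) +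
      2 ^ b * rho b l *
        ((if h = 0 then 0 else rho b h) + (if h + l = 0 then 0 else rho b (h + l))) := by
  have hr := rho_pos b
  have h2 : (0 : ℝ) < 2 ^ b := by positivity
  by_cases h0 : h = 0
  · subst h0
    simp only [if_true, zero_add, rho_zero, one_mul, if_neg hl]
    have : (0:ℤ) ≠ -l := by simpa [eq_comm] using hl
    rw [if_neg this]
    have := mul_pos (mul_pos h2 (hr l)) (hr l)
    linarith
  · by_cases h1 : h = -l
    · subst h1
      simp only [if_neg h0, neg_add_cancel, rho_zero, if_true, rho_neg]
      have := mul_pos (mul_pos h2 (hr l)) (hr l)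
      linarith
    · have h3 : h + l ≠ 0 := fun h4 => h1 (by lia)
      simp only [if_neg h0, if_neg h1, if_neg h3, zero_add]
      rcases le_or_gt |l| (2 * |h|) with hle | hlt
      · have h4 := rho_le_of_abs_le hb hl hle
        have h5 := mul_le_mul_of_nonneg_right h4 (hr (h + l)).le
        have := mul_pos (mul_pos h2 (hr l)) (hr h)
        linarith
      · have hle : |l| ≤ 2 * |h + l| := by
          rcases abs_cases l with h4 | h4 <;> rcases abs_cases h with h5 | h5 <;>
            rcases abs_cases (h + l) with h6 | h6 <;> lia
        have h4 := rho_le_of_abs_le hb hl hle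
        have h5 := mul_le_mul_of_nonneg_left h4 (hr h).le
        have := mul_pos (mul_pos h2 (hr l)) (hr (h + l))
        linarith

lemma tsum_rho_mul_rho_le {b : ℝ} (hb : 1 < b) {l : ℤ} (hl : l ≠ 0) :
    ∑' h, ENNReal.ofReal (rho b h) * ENNReal.ofReal (rho b (h + l)) ≤
      ENNReal.ofReal (rho b l) * ENNReal.ofReal (2 + 2 ^ (b + 1) * omega b) := by
  have hr := fun h => (rho_pos b h).le
  have h2 : (0 : ℝ) < 2 ^ b := by positivity
  have hw := omega_nonneg b
  set e : ℝ≥0∞ := ENNReal.ofReal (rho b l) with he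
  calc ∑' h, ENNReal.ofReal (rho b h) * ENNReal.ofReal (rho b (h + l))
      ≤ ∑' h : ℤ, ((if h = 0 then e else 0) + (if h = -l then e else 0) +
          ENNReal.ofReal (2 ^ b) * e * ((if h = 0 then 0 else ENNReal.ofReal (rho b h)) +
            (if h + l = 0 then 0 else ENNReal.ofReal (rho b (h + l))))) := by
        refine ENNReal.tsum_le_tsum fun h => ?_
        rw [← ENNReal.ofReal_mul (hr h)]
        refine (ENNReal.ofReal_le_ofReal (rho_mul_rho_le (by linarith) hl h)).trans_eq ?_
        have p1 : ∀ (P : Prop) [Decidable P] (x : ℝ), 0 ≤ x → 0 ≤ if P then x else 0 := by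
          intro P _ x hx; split_ifs <;> simp [hx]
        have p2 : ∀ (P : Prop) [Decidable P] (x : ℝ), 0 ≤ x → 0 ≤ if P then 0 else x := by
          intro P _ x hx; split_ifs <;> simp [hx]
        rw [ENNReal.ofReal_add (add_nonneg (p1 _ _ (hr l)) (p1 _ _ (hr l)))
            (mul_nonneg (mul_nonneg h2.le (hr l)) (add_nonneg (p2 _ _ (hr h)) (p2 _ _ (hr _)))),
          ENNReal.ofReal_add (p1 _ _ (hr l)) (p1 _ _ (hr l)),
          ENNReal.ofReal_mul (mul_nonneg h2.le (hr l)), ENNReal.ofReal_mul h2.le,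
          ENNReal.ofReal_add (p2 _ _ (hr h)) (p2 _ _ (hr _))]
        simp only [apply_ite ENNReal.ofReal, ENNReal.ofReal_zero]
        rfl
    _ = e + e + ENNReal.ofReal (2 ^ b) * e *
          (ENNReal.ofReal (omega b) + ENNReal.ofReal (omega b)) := by
        rw [ENNReal.tsum_add, ENNReal.tsum_add, tsum_ite_eq, tsum_ite_eq, ENNReal.tsum_mul_left,
          ENNReal.tsum_add, tsum_rho_ne_zero hb]
        have : ∑' h : ℤ, (if h + l = 0 then 0 else ENNReal.ofReal (rho b (h + l))) =
            ENNReal.ofReal (omega b) :=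
          ((Equiv.addRight l).tsum_eq
            (fun h : ℤ => if h = 0 then 0 else ENNReal.ofReal (rho b h))).trans
            (tsum_rho_ne_zero hb)
        rw [this]
    _ = _ := by
        rw [ENNReal.ofReal_add zero_le_two (by positivity), ENNReal.ofReal_mul (by positivity),
          Real.rpow_add two_pos, Real.rpow_one, ENNReal.ofReal_mul h2.le]
        simp only [ENNReal.ofReal_ofNat]
        ring

/-- The exact factor is N^{-b}; only N^{-1} is kept, the order that averaging over candidates gives
as well. -/
lemma rho_natCast_mul_le {b : ℝ} (hb : 1 < b) {N : ℕ} (hN : 1 ≤ N) {m : ℤ} (hm : m ≠ 0) :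
    rho b (N * m) ≤ rho b m / N := by
  have hN' : (1 : ℝ) ≤ N := by exact_mod_cast hN
  have hpi := Real.pi_pos
  rw [rho, rho, if_neg hm, if_neg (mul_ne_zero (by lia) hm)]
  push_cast
  rw [abs_mul, Nat.abs_cast, show 2 * Real.pi * ((N : ℝ) * |(m : ℝ)|) =
    N * (2 * Real.pi * |(m : ℝ)|) by ring, Real.mul_rpow (by positivity) (by positivity),
    div_eq_inv_mul]
  gcongr
  rw [← Real.rpow_neg_one]
  exact Real.rpow_le_rpow_of_exponent_le hN' (by linarith)

lemma tsum_rho_dvd_le {b : ℝ} (hb : 1 < b) {N : ℕ} (hN : 1 ≤ N) :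
    ∑' l : ℤ, (if l ≠ 0 ∧ (N : ℤ) ∣ l then ENNReal.ofReal (rho b l) else 0) ≤
      ENNReal.ofReal (omega b / N) := by
  have hinj : Function.Injective fun m : ℤ => (N : ℤ) * m := fun x y hxy =>
    mul_left_cancel₀ (by lia : (N : ℤ) ≠ 0) hxy
  rw [← hinj.tsum_eq]
  · have hN' : (0 : ℝ) < N := by exact_mod_cast hN
    rw [div_eq_inv_mul, ENNReal.ofReal_mul (by positivity), ← tsum_rho_ne_zero hb,
      ← ENNReal.tsum_mul_left]
    refine ENNReal.tsum_le_tsum fun m => ?_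
    by_cases hm : m = 0
    · simp [hm]
    · rw [if_neg hm, if_pos ⟨mul_ne_zero (by lia) hm, dvd_mul_right _ _⟩,
        ← ENNReal.ofReal_mul (by positivity), ← div_eq_inv_mul]
      exact ENNReal.ofReal_le_ofReal (rho_natCast_mul_le hb hN hm)
  · intro l hl
    have : l ≠ 0 ∧ (N : ℤ) ∣ l := by
      by_contra h
      simp [h] at hl
    obtain ⟨m, hm⟩ := this.2
    exact ⟨m, hm.symm⟩

/-- The correlation sum over the nonzero multiples of `N`. -/
lemma tsum_correlation_dvd_le {b : ℝ} (hb : 1 < b) {N : ℕ} (hN : 1 ≤ N) :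
    ∑' p : ℤ × ℤ, (if p.2 ≠ 0 ∧ (N : ℤ) ∣ p.2 then
      ENNReal.ofReal (rho b p.1) * ENNReal.ofReal (rho b (p.1 + p.2)) else 0) ≤
      ENNReal.ofReal (omega b * (2 + 2 ^ (b + 1) * omega b) / N) := by
  have hw := omega_nonneg b
  rw [ENNReal.tsum_prod', ENNReal.tsum_comm]
  calc _ ≤ ∑' l : ℤ, (if l ≠ 0 ∧ (N : ℤ) ∣ l then ENNReal.ofReal (rho b l) else 0) *
        ENNReal.ofReal (2 + 2 ^ (b + 1) * omega b) := by
        refine ENNReal.tsum_le_tsum fun l => ?_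
        split_ifs with hl
        · exact tsum_rho_mul_rho_le hb hl.1
        · simp
    _ ≤ ENNReal.ofReal (omega b / N) * ENNReal.ofReal (2 + 2 ^ (b + 1) * omega b) := by
        rw [ENNReal.tsum_mul_right]
        gcongr
        exact tsum_rho_dvd_le hb hN
    _ = _ := by
        rw [← ENNReal.ofReal_mul (by positivity)]
        congr 1
        ring

/-- For fixed h the shift by h decouples the two factors. -/
lemma tsum_correlation {b : ℝ} (hb : 1 < b) :
    ∑' p : ℤ × ℤ, ENNReal.ofReal (rho b p.1) * ENNReal.ofReal (rho b (p.1 + p.2)) =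
      ENNReal.ofReal (1 + omega b) ^ 2 := by
  rw [ENNReal.tsum_prod', sq, ← tsum_rho hb, ← ENNReal.tsum_mul_right]
  refine tsum_congr fun h => ?_
  simp only
  rw [ENNReal.tsum_mul_left]
  congr 1
  exact (Equiv.addLeft h).tsum_eq fun k => ENNReal.ofReal (rho b k)

/-! ### The component-by-component criterion -/

/-- The summand `r(h)^{-2} r(h+ℓ)^{-2}` of the criterion, at the pair `p = (h, ℓ)`. -/
def critTerm {d : ℕ} (α : ℕ) (p : (Fin d → ℤ) × (Fin d → ℤ)) : ℝ :=
  (weight α (1 / 2) p.1 ^ 2 * weight α (1 / 2) (p.1 + p.2) ^ 2)⁻¹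

/-- The last nonzero component of `l` is the one with index `s`. -/
def LastNonzero {d : ℕ} (s : Fin d) (l : Fin d → ℤ) : Prop :=
  l s ≠ 0 ∧ ∀ j, s < j → l j = 0

/-- The dual lattice condition `ℓ·z ≡ 0 (mod N)`. -/
def InDual {d : ℕ} (N : ℕ) (z : Fin d → ℕ) (l : Fin d → ℤ) : Prop :=
  (N : ℤ) ∣ ∑ j, l j * (z j : ℤ)

open Classical in
lemma cbcCriterion_eq {d : ℕ} (α N : ℕ) (s : Fin d) (z : Fin d → ℕ) :
    cbcCriterion α N s z = ∑' p : (Fin d → ℤ) × (Fin d → ℤ),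
      if LastNonzero s p.2 ∧ InDual N z p.2 then critTerm α p else 0 := by
  unfold cbcCriterion LastNonzero InDual critTerm
  refine tsum_congr fun p => ?_
  simp only [and_assoc]

lemma critTerm_eq_prod {d : ℕ} (α : ℕ) (p : (Fin d → ℤ) × (Fin d → ℤ)) :
    critTerm α p = ∏ j, rho (2 * α) (p.1 j) * rho (2 * α) (p.1 j + p.2 j) := by
  simp only [critTerm, weight, mul_inv, ← Finset.prod_pow, ← Finset.prod_inv_distrib,
    inv_weight₁_sq, Finset.prod_mul_distrib, Pi.add_apply]

lemma critTerm_pos {d : ℕ} (α : ℕ) (p : (Fin d → ℤ) × (Fin d → ℤ)) : 0 < critTerm α p := by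
  rw [critTerm_eq_prod]
  exact Finset.prod_pos fun j _ => mul_pos (rho_pos _ _) (rho_pos _ _)

lemma ofReal_critTerm_rpow {d : ℕ} (α : ℕ) (p : (Fin d → ℤ) × (Fin d → ℤ)) (q : ℝ) :
    ENNReal.ofReal (critTerm α p) ^ q =
      ∏ j, ENNReal.ofReal (rho (2 * α * q) (p.1 j)) *
        ENNReal.ofReal (rho (2 * α * q) (p.1 j + p.2 j)) := by
  rw [ENNReal.ofReal_rpow_of_pos (critTerm_pos α p), critTerm_eq_prod,
    ← Real.finsetProd_rpow _ _ fun j _ => (mul_pos (rho_pos _ _) (rho_pos _ _)).le,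
    ENNReal.ofReal_prod_of_nonneg fun j _ => Real.rpow_nonneg
      (mul_pos (rho_pos _ _) (rho_pos _ _)).le _]
  refine Finset.prod_congr rfl fun j _ => ?_
  rw [Real.mul_rpow (rho_pos _ _).le (rho_pos _ _).le, rho_rpow, rho_rpow,
    ENNReal.ofReal_mul (rho_pos _ _).le]

lemma tsum_pair_prod {d : ℕ} (F : Fin d → ℤ → ℤ → ℝ≥0∞) :
    ∑' p : (Fin d → ℤ) × (Fin d → ℤ), ∏ j, F j (p.1 j) (p.2 j) =
      ∏ j, ∑' q : ℤ × ℤ, F j q.1 q.2 := by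
  rw [← tsum_pi_prod fun j (q : ℤ × ℤ) => F j q.1 q.2,
    ← (Equiv.arrowProdEquivProdArrow (Fin d) (fun _ => ℤ) (fun _ => ℤ)).tsum_eq]
  rfl

lemma tsum_critTerm_rpow {d α : ℕ} {q : ℝ} (hb : 1 < 2 * α * q) :
    ∑' p : (Fin d → ℤ) × (Fin d → ℤ), ENNReal.ofReal (critTerm α p) ^ q =
      ENNReal.ofReal ((1 + omega (2 * α * q)) ^ (2 * d)) := by
  have hw := omega_nonneg (2 * α * q)
  simp only [ofReal_critTerm_rpow]
  rw [tsum_pair_prod fun _ h l => ENNReal.ofReal (rho (2 * α * q) h) *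
    ENNReal.ofReal (rho (2 * α * q) (h + l))]
  simp only [tsum_correlation hb, Finset.prod_const, Finset.card_univ, Fintype.card_fin]
  rw [← ENNReal.ofReal_pow (by positivity), ← ENNReal.ofReal_pow (by positivity), pow_mul]

lemma summable_critTerm {d α : ℕ} (hα : 1 ≤ α) :
    Summable fun p : (Fin d → ℤ) × (Fin d → ℤ) => critTerm α p := by
  have hα' : (1 : ℝ) ≤ α := by exact_mod_cast hα
  have h := tsum_critTerm_rpow (d := d) (α := α) (q := 1) (by linarith)
  simp only [ENNReal.rpow_one] at h
  have h2 := ENNReal.summable_toReal (h.trans_ne ENNReal.ofReal_ne_top)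
  simpa only [ENNReal.toReal_ofReal (critTerm_pos α _).le] using h2

open Classical in
lemma ofReal_cbcCriterion {d α : ℕ} (hα : 1 ≤ α) (N : ℕ) (s : Fin d) (z : Fin d → ℕ) :
    ENNReal.ofReal (cbcCriterion α N s z) = ∑' p : (Fin d → ℤ) × (Fin d → ℤ),
      if LastNonzero s p.2 ∧ InDual N z p.2 then ENNReal.ofReal (critTerm α p) else 0 := by
  have h0 : ∀ p : (Fin d → ℤ) × (Fin d → ℤ),
      0 ≤ if LastNonzero s p.2 ∧ InDual N z p.2 then critTerm α p else 0 := by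
    intro p
    split_ifs
    exacts [(critTerm_pos α p).le, le_rfl]
  rw [cbcCriterion_eq, ENNReal.ofReal_tsum_of_nonneg h0]
  · simp only [apply_ite ENNReal.ofReal, ENNReal.ofReal_zero]
  · refine (summable_critTerm hα).of_nonneg_of_le h0 fun p => ?_
    split_ifs
    exacts [le_rfl, (critTerm_pos α p).le]

lemma exists_lastNonzero {d : ℕ} {l : Fin d → ℤ} (hl : l ≠ 0) : ∃ s, LastNonzero s l := by
  classical
  obtain ⟨i, hi⟩ := Function.ne_iff.1 hl
  have hne : (Finset.univ.filter fun j => l j ≠ 0).Nonempty := ⟨i, by simpa using hi⟩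
  refine ⟨_, (Finset.mem_filter.1 (Finset.max'_mem _ hne)).2, fun j hj => ?_⟩
  by_contra h
  exact absurd (Finset.le_max' _ j (by simpa using h)) (not_le.2 hj)

lemma LastNonzero.eq {d : ℕ} {l : Fin d → ℤ} {s t : Fin d} (hs : LastNonzero s l)
    (ht : LastNonzero t l) : s = t := by
  rcases lt_trichotomy s t with h | h | h
  · exact absurd (hs.2 t h) ht.1
  · exact h
  · exact absurd (ht.2 s h) hs.1

open Classical in
/-- The full criterion `∑_h ∑_{0 ≠ ℓ, ℓ·z ≡ 0} r(h)^{-2} r(h+ℓ)^{-2}`. -/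
def dualSum {d : ℕ} (α N : ℕ) (z : Fin d → ℕ) : ℝ≥0∞ :=
  ∑' p : (Fin d → ℤ) × (Fin d → ℤ),
    if p.2 ≠ 0 ∧ InDual N z p.2 then ENNReal.ofReal (critTerm α p) else 0

/-- Every nonzero ℓ is counted under the index of its last nonzero component. -/
lemma dualSum_le_sum {d α : ℕ} (hα : 1 ≤ α) (N : ℕ) (z : Fin d → ℕ) :
    dualSum α N z ≤ ∑ s, ENNReal.ofReal (cbcCriterion α N s z) := by
  classical
  simp only [ofReal_cbcCriterion hα]
  rw [← Summable.tsum_finsetSum fun _ _ => ENNReal.summable]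
  refine ENNReal.tsum_le_tsum fun p => ?_
  split_ifs with hp
  · obtain ⟨s, hs⟩ := exists_lastNonzero hp.1
    refine le_trans ?_ (Finset.single_le_sum (fun _ _ => zero_le) (Finset.mem_univ s))
    rw [if_pos ⟨hs, hp.2⟩]
  · exact zero_le

open Classical in
lemma sum_lastNonzero_le {d : ℕ} (l : Fin d → ℤ) (x : ℝ≥0∞) :
    ∑ s, (if LastNonzero s l then x else 0) ≤ x := by
  by_cases h : ∃ s, LastNonzero s l
  · obtain ⟨s, hs⟩ := h
    rw [Finset.sum_eq_single s]
    · rw [if_pos hs]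
    · intro t _ ht
      rw [if_neg fun h => ht (h.eq hs)]
    · simp
  · rw [Finset.sum_eq_zero]
    · exact zero_le
    · intro s _
      rw [if_neg fun hs => h ⟨s, hs⟩]

/-! ### Averaging over the candidate components -/

lemma sum_mul_update {d : ℕ} (l : Fin d → ℤ) (z : Fin d → ℕ) (s : Fin d) (c : ℕ) :
    ∑ j, l j * ((Function.update z s c) j : ℤ) =
      l s * c + ∑ j ∈ Finset.univ.erase s, l j * (z j : ℤ) := by
  rw [← Finset.add_sum_erase _ _ (Finset.mem_univ s), Function.update_self]
  congr 1
  refine Finset.sum_congr rfl fun j hj => ?_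
  rw [Function.update_of_ne (Finset.ne_of_mem_erase hj)]

open Classical in
/-- For `N ∤ ℓ_s` at most one component `c` puts `ℓ` into the dual lattice. -/
lemma sum_inDual_update_le {d N : ℕ} (hN : N.Prime) (s : Fin d) (z : Fin d → ℕ) (l : Fin d → ℤ)
    (x : ℝ≥0∞) :
    ∑ c ∈ Finset.Ico 1 N, (if LastNonzero s l ∧ InDual N (Function.update z s c) l then x else 0) ≤
      (if LastNonzero s l then x else 0) +
        ((N - 1 : ℕ) : ℝ≥0∞) * (if l s ≠ 0 ∧ (N : ℤ) ∣ l s then x else 0) := by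
  by_cases hs : LastNonzero s l
  swap
  · simp [hs]
  by_cases hd : (N : ℤ) ∣ l s
  · rw [if_pos (⟨hs.1, hd⟩ : l s ≠ 0 ∧ (N : ℤ) ∣ l s)]
    refine le_trans ?_ le_add_self
    refine (Finset.sum_le_card_nsmul _ _ x fun c _ => ?_).trans_eq ?_
    · split_ifs
      exacts [le_rfl, zero_le]
    · simp
  · rw [if_pos hs, ← Finset.sum_filter, Finset.sum_const]
    refine le_trans ?_ le_self_add
    have hcard : (Finset.filter (fun c => LastNonzero s l ∧ InDual N (Function.update z s c) l)
        (Finset.Ico 1 N)).card ≤ 1 := by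
      refine Finset.card_le_one.2 fun c hc c' hc' => ?_
      simp only [Finset.mem_filter, Finset.mem_Ico, InDual, sum_mul_update] at hc hc'
      -- Subtraction leaves N ∣ ℓ_s(c − c'). As N is a prime not dividing ℓ_s, it divides c − c',
      -- and |c − c'| < N.
      have h1 := dvd_sub hc.2.2 hc'.2.2
      rw [add_sub_add_right_eq_sub, ← mul_sub] at h1
      have h2 := ((Nat.prime_iff_prime_int.1 hN).dvd_or_dvd h1).resolve_left hd
      have h3 := Int.eq_zero_of_abs_lt_dvd h2 (abs_lt.2 ⟨by lia, by lia⟩)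
      lia
    calc _ ≤ 1 • x := by gcongr
      _ = x := one_nsmul x

-- The minimum is at most each candidate's value, so N−1 copies of it are at most the sum over all
-- candidates. Subadditivity moves the power q onto the terms, and exchanging the sums reduces the
-- claim to counting, for each ℓ, the candidates that put it into the dual lattice.
open Classical in
lemma card_mul_cbcCriterion_rpow_le {d α N : ℕ} (hα : 1 ≤ α) (hN : N.Prime) {z : Fin d → ℕ}
    (hz : IsCBCVector α N z) (s : Fin d) {q : ℝ} (hq : 0 < q) (hq1 : q ≤ 1) :
    ((N - 1 : ℕ) : ℝ≥0∞) * ENNReal.ofReal (cbcCriterion α N s z) ^ q ≤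
      ∑' p : (Fin d → ℤ) × (Fin d → ℤ),
        (if LastNonzero s p.2 then ENNReal.ofReal (critTerm α p) ^ q else 0) +
      ((N - 1 : ℕ) : ℝ≥0∞) * ∑' p : (Fin d → ℤ) × (Fin d → ℤ),
        (if p.2 s ≠ 0 ∧ (N : ℤ) ∣ p.2 s then ENNReal.ofReal (critTerm α p) ^ q else 0) := by
  calc ((N - 1 : ℕ) : ℝ≥0∞) * ENNReal.ofReal (cbcCriterion α N s z) ^ q
      = ∑ c ∈ Finset.Ico 1 N, ENNReal.ofReal (cbcCriterion α N s z) ^ q := by simp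
    _ ≤ ∑ c ∈ Finset.Ico 1 N,
          ENNReal.ofReal (cbcCriterion α N s (Function.update z s c)) ^ q := by
        refine Finset.sum_le_sum fun c hc => ?_
        rw [Finset.mem_Ico] at hc
        gcongr
        exact (hz s).2 c hc.1 hc.2
    _ ≤ ∑ c ∈ Finset.Ico 1 N, ∑' p : (Fin d → ℤ) × (Fin d → ℤ),
          (if LastNonzero s p.2 ∧ InDual N (Function.update z s c) p.2 then
            ENNReal.ofReal (critTerm α p) ^ q else 0) := by
        refine Finset.sum_le_sum fun c _ => ?_
        rw [ofReal_cbcCriterion hα]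
        refine (rpow_tsum_le_tsum_rpow _ hq hq1).trans_eq (tsum_congr fun p => ?_)
        split_ifs
        · rfl
        · exact ENNReal.zero_rpow_of_pos hq
    _ = ∑' p : (Fin d → ℤ) × (Fin d → ℤ), ∑ c ∈ Finset.Ico 1 N,
          (if LastNonzero s p.2 ∧ InDual N (Function.update z s c) p.2 then
            ENNReal.ofReal (critTerm α p) ^ q else 0) :=
        (Summable.tsum_finsetSum fun _ _ => ENNReal.summable).symm
    _ ≤ _ := by
        rw [← ENNReal.tsum_mul_left, ← ENNReal.tsum_add]
        exact ENNReal.tsum_le_tsum fun p => sum_inDual_update_le hN s z p.2 _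

-- The condition concerns only coordinate s. The sum thus factors into d−1 unrestricted correlation
-- sums and one over nonzero multiples of N, the latter supplying the 1/N.
open Classical in
lemma tsum_critTerm_rpow_dvd_le {d α N : ℕ} (hN : 1 ≤ N) (s : Fin d) {q : ℝ}
    (hb : 1 < 2 * α * q) :
    ∑' p : (Fin d → ℤ) × (Fin d → ℤ),
        (if p.2 s ≠ 0 ∧ (N : ℤ) ∣ p.2 s then ENNReal.ofReal (critTerm α p) ^ q else 0) ≤
      ENNReal.ofReal ((1 + omega (2 * α * q)) ^ (2 * (d - 1)) *
        (omega (2 * α * q) * (2 + 2 ^ (2 * α * q + 1) * omega (2 * α * q)) / N)) := by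
  set b : ℝ := 2 * α * q with hbdef
  have hw := omega_nonneg b
  let F : Fin d → ℤ → ℤ → ℝ≥0∞ := fun j h l =>
    if j = s → (l ≠ 0 ∧ (N : ℤ) ∣ l) then ENNReal.ofReal (rho b h) * ENNReal.ofReal (rho b (h + l))
    else 0
  have h1 : ∀ p : (Fin d → ℤ) × (Fin d → ℤ),
      (if p.2 s ≠ 0 ∧ (N : ℤ) ∣ p.2 s then ENNReal.ofReal (critTerm α p) ^ q else 0) =
        ∏ j, F j (p.1 j) (p.2 j) := by
    intro p
    split_ifs with hp
    · rw [ofReal_critTerm_rpow]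
      refine Finset.prod_congr rfl fun j _ => ?_
      have : j = s → (p.2 j ≠ 0 ∧ (N : ℤ) ∣ p.2 j) := by rintro rfl; exact hp
      simp only [F, if_pos this]
      rfl
    · symm
      refine Finset.prod_eq_zero (Finset.mem_univ s) ?_
      exact if_neg fun h => hp (h rfl)
  have hs : ∑' x : ℤ × ℤ, F s x.1 x.2 ≤
      ENNReal.ofReal (omega b * (2 + 2 ^ (b + 1) * omega b) / N) := by
    refine le_trans (le_of_eq (tsum_congr fun x => ?_)) (tsum_correlation_dvd_le hb hN)
    simp only [F, forall_const]
  have hj : ∀ j ∈ Finset.univ.erase s, ∑' x : ℤ × ℤ, F j x.1 x.2 =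
      ENNReal.ofReal (1 + omega b) ^ 2 := by
    intro j hj
    rw [← tsum_correlation hb]
    refine tsum_congr fun x => ?_
    simp only [F]
    exact if_pos fun h => absurd h (Finset.ne_of_mem_erase hj)
  simp only [h1]
  rw [tsum_pair_prod, ← Finset.prod_erase_mul _ _ (Finset.mem_univ s), Finset.prod_congr rfl hj,
    Finset.prod_const, Finset.card_erase_of_mem (Finset.mem_univ s), Finset.card_univ,
    Fintype.card_fin, ← pow_mul, ENNReal.ofReal_mul (by positivity),
    ENNReal.ofReal_pow (by positivity)]
  gcongr

/-- The averaging bound for the criterion at a vector constructed component by component. -/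
lemma dualSum_rpow_le {d α N : ℕ} (hα : 1 ≤ α) (hN : N.Prime) {z : Fin d → ℕ}
    (hz : IsCBCVector α N z) {q : ℝ} (hq : 0 < q) (hq1 : q ≤ 1) (hb : 1 < 2 * α * q) :
    dualSum α N z ^ q ≤ ENNReal.ofReal ((1 + omega (2 * α * q)) ^ (2 * d) / ((N : ℝ) - 1) +
      d * ((1 + omega (2 * α * q)) ^ (2 * (d - 1)) *
        (omega (2 * α * q) * (2 + 2 ^ (2 * α * q + 1) * omega (2 * α * q)) / N))) := by
  classical
  have hN2 := hN.two_le
  have hw := omega_nonneg (2 * α * q)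
  have hn : (((N - 1 : ℕ) : ℝ)) = (N : ℝ) - 1 := by
    rw [Nat.cast_sub hN.one_lt.le, Nat.cast_one]
  have hn0 : (0 : ℝ) < ((N - 1 : ℕ) : ℝ) := by
    have : 0 < N - 1 := by lia
    exact_mod_cast this
  set D : ℝ := (1 + omega (2 * α * q)) ^ (2 * (d - 1)) *
        (omega (2 * α * q) * (2 + 2 ^ (2 * α * q + 1) * omega (2 * α * q)) / N) with hD
  have hD0 : 0 ≤ D := by positivity
  have key : ((N - 1 : ℕ) : ℝ≥0∞) * ∑ s, ENNReal.ofReal (cbcCriterion α N s z) ^ q ≤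
      ((N - 1 : ℕ) : ℝ≥0∞) * ENNReal.ofReal ((1 + omega (2 * α * q)) ^ (2 * d) / ((N : ℝ) - 1) +
        d * D) := by
    rw [Finset.mul_sum]
    refine (Finset.sum_le_sum fun s _ =>
      card_mul_cbcCriterion_rpow_le hα hN hz s hq hq1).trans ?_
    rw [Finset.sum_add_distrib, ENNReal.ofReal_add (by rw [← hn]; positivity) (by positivity),
      mul_add]
    gcongr
    -- The classes of ℓ by last nonzero index are disjoint, so summing over s costs no factor d
    -- here; the multiples of N below do cost one.
    · rw [← Summable.tsum_finsetSum fun _ _ => ENNReal.summable]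
      refine (ENNReal.tsum_le_tsum fun p : (Fin d → ℤ) × (Fin d → ℤ) =>
        sum_lastNonzero_le p.2 _).trans_eq ?_
      rw [tsum_critTerm_rpow hb, ← ENNReal.ofReal_natCast, ← ENNReal.ofReal_mul hn0.le, ← hn,
        mul_div_cancel₀ _ hn0.ne']
    · rw [← Finset.mul_sum]
      gcongr
      refine (Finset.sum_le_sum fun s _ =>
        tsum_critTerm_rpow_dvd_le hN.one_lt.le s hb).trans_eq ?_
      rw [Finset.sum_const, Finset.card_univ, Fintype.card_fin, nsmul_eq_mul,
        ← ENNReal.ofReal_natCast, ← ENNReal.ofReal_mul (by positivity)]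
  have hne : ((N - 1 : ℕ) : ℝ≥0∞) ≠ 0 := by
    have : N - 1 ≠ 0 := by lia
    exact_mod_cast this
  rw [ENNReal.mul_le_mul_iff_right hne (ENNReal.natCast_ne_top _)] at key
  refine le_trans ?_ ((rpow_sum_le_sum_rpow _ _ hq hq1).trans key)
  gcongr
  exact dualSum_le_sum hα N z

/-! ### Existence -/

/-- Components of z beyond s are multiplied by vanishing ℓ_j. Later choices therefore cannot spoil
the minimality of earlier ones. -/
lemma cbcCriterion_congr {d : ℕ} (α N : ℕ) (s : Fin d) {z z' : Fin d → ℕ}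
    (h : ∀ j ≤ s, z j = z' j) : cbcCriterion α N s z = cbcCriterion α N s z' := by
  classical
  rw [cbcCriterion_eq, cbcCriterion_eq]
  refine tsum_congr fun p => ?_
  have : LastNonzero s p.2 → (InDual N z p.2 ↔ InDual N z' p.2) := by
    intro hs
    unfold InDual
    have : ∑ j, p.2 j * (z j : ℤ) = ∑ j, p.2 j * (z' j : ℤ) := by
      refine Finset.sum_congr rfl fun j _ => ?_
      rcases le_or_gt j s with hj | hj
      · rw [h j hj]
      · rw [hs.2 j hj, zero_mul, zero_mul]
    rw [this]
  simp only [and_congr_right_iff.2 this]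

lemma exists_isCBCVector {N : ℕ} (hN : 2 ≤ N) (α d : ℕ) :
    ∃ z : Fin d → ℕ, IsCBCVector α N z := by
  have main : ∀ n ≤ d, ∃ z : Fin d → ℕ, ∀ s : Fin d, (s : ℕ) < n → (1 ≤ z s ∧ z s < N) ∧
      ∀ c : ℕ, 1 ≤ c → c < N →
        cbcCriterion α N s z ≤ cbcCriterion α N s (Function.update z s c) := by
    intro n
    induction n with
    | zero => exact fun _ => ⟨0, fun s hs => absurd hs (by lia)⟩
    | succ n ih =>
      intro hn
      obtain ⟨z, hz⟩ := ih (by lia)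
      let t : Fin d := ⟨n, hn⟩
      obtain ⟨c₀, hc₀, hmin⟩ := Finset.exists_min_image (Finset.Ico 1 N)
        (fun c => cbcCriterion α N t (Function.update z t c)) ⟨1, by simp; lia⟩
      rw [Finset.mem_Ico] at hc₀
      refine ⟨Function.update z t c₀, fun s hs => ?_⟩
      rcases eq_or_ne s t with rfl | hst
      · rw [Function.update_self]
        refine ⟨hc₀, fun c h1 h2 => ?_⟩
        rw [Function.update_idem]
        exact hmin c (Finset.mem_Ico.2 ⟨h1, h2⟩)
      · have hlt : s < t := by
          refine lt_of_le_of_ne ?_ hst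
          rw [Fin.le_def]
          exact Nat.lt_succ_iff.1 hs
        obtain ⟨h1, h2⟩ := hz s hlt
        rw [Function.update_of_ne hst]
        refine ⟨h1, fun c hc1 hc2 => ?_⟩
        have hle : ∀ j ≤ s, j ≠ t := fun j hj => (hj.trans_lt hlt).ne
        have hc := fun y : Fin d → ℕ => cbcCriterion_congr α N s (z := Function.update y t c₀)
          fun j hj => Function.update_of_ne (hle j hj) c₀ y
        rw [Function.update_comm hst.symm, hc, hc]
        exact h2 c hc1 hc2
  obtain ⟨z, hz⟩ := main d le_rfl
  exact ⟨z, fun s => hz s s.2⟩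

/-! ### Fourier series on the box -/

lemma trig_mul_conj {a : ℝ} (ha : 0 < a) (h k : ℤ) (x : ℝ) :
    trig a h x * conj (trig a k x) = ((1 / (2 * a) : ℝ) : ℂ) *
      Complex.exp (((2 * Real.pi * (h - k : ℤ) * ((x + a) / (2 * a)) : ℝ) : ℂ) * Complex.I) := by
  unfold trig
  rw [map_mul, Complex.conj_ofReal, ← Complex.exp_conj, map_mul, Complex.conj_ofReal,
    Complex.conj_I, mul_mul_mul_comm, ← Complex.exp_add, ← Complex.ofReal_mul]
  congr 2
  · rw [← sq, div_pow, one_pow, Real.sq_sqrt (by positivity)]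
  · push_cast
    ring

lemma integral_trig_mul_conj {a : ℝ} (ha : 0 < a) (h k : ℤ) :
    ∫ x in Set.Icc (-a) a, trig a h x * conj (trig a k x) = if h = k then 1 else 0 := by
  simp only [trig_mul_conj ha]
  rw [integral_const_mul, integral_Icc_eq_integral_Ioc,
    ← intervalIntegral.integral_of_le (by linarith)]
  have ha' : (a : ℂ) ≠ 0 := by exact_mod_cast ha.ne'
  split_ifs with hk
  · subst hk
    simp
    field_simp
    ring
  · have hn : ((h - k : ℤ) : ℂ) ≠ 0 := by exact_mod_cast sub_ne_zero.2 hk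
    set n : ℤ := h - k with hndef
    set c : ℂ := 2 * Real.pi * n / (2 * a) * Complex.I with hc
    have hpi : (Real.pi : ℂ) ≠ 0 := by exact_mod_cast Real.pi_ne_zero
    have hc0 : c ≠ 0 := by
      simp only [hc]
      exact mul_ne_zero (div_ne_zero (mul_ne_zero (mul_ne_zero two_ne_zero hpi) hn)
        (mul_ne_zero two_ne_zero ha')) Complex.I_ne_zero
    have he : ∀ x : ℝ,
        Complex.exp (((2 * Real.pi * (n : ℝ) * ((x + a) / (2 * a)) : ℝ) : ℂ) * Complex.I) =
          Complex.exp (c * x) * Complex.exp (c * a) := by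
      intro x
      rw [← Complex.exp_add]
      congr 1
      simp only [hc]
      push_cast
      field_simp
    simp only [he]
    rw [intervalIntegral.integral_mul_const, integral_exp_mul_complex hc0]
    -- The antiderivative has equal values at both endpoints, because 2ac = 2πi n.
    have h2 : Complex.exp (c * a) = Complex.exp (c * (-a : ℝ)) := by
      rw [Complex.exp_eq_exp_iff_exists_int]
      refine ⟨n, ?_⟩
      simp only [hc]
      push_cast
      field_simp
      ring
    rw [h2]
    simp

lemma integral_trigProd_mul_conj {d : ℕ} {a : ℝ} (ha : 0 < a) (h k : Fin d → ℤ) :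
    ∫ x : Box a d, trigProd a h x * conj (trigProd a k x) = if h = k then 1 else 0 := by
  have h1 : ∀ x : Box a d, trigProd a h x * conj (trigProd a k x) =
      (fun y : Fin d → ℝ => ∏ j, trig a (h j) (y j) * conj (trig a (k j) (y j))) x.1 := by
    intro x
    simp only [trigProd, map_prod, Finset.prod_mul_distrib]
  simp only [h1]
  have h2 := integral_subtype_comap (μ := (volume : Measure (Fin d → ℝ)))
    (s := Set.Icc (fun _ : Fin d => -a) (fun _ : Fin d => a)) measurableSet_Icc
    (fun y : Fin d → ℝ => ∏ j, trig a (h j) (y j) * conj (trig a (k j) (y j)))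
  refine h2.trans ?_
  rw [← Set.pi_univ_Icc, volume_pi, Measure.restrict_pi_pi,
    integral_fintype_prod_eq_prod (f := fun j y => trig a (h j) y * conj (trig a (k j) y))]
  simp only [integral_trig_mul_conj ha]
  split_ifs with hk
  · subst hk
    simp
  · obtain ⟨j, hj⟩ := Function.ne_iff.1 hk
    exact Finset.prod_eq_zero (Finset.mem_univ j) (if_neg hj)

lemma integrable_of_continuous {d : ℕ} {a : ℝ} {E : Type*} [NormedAddCommGroup E]
    [SecondCountableTopology E] {v : Box a d → E} (hv : Continuous v) : Integrable v := by
  obtain ⟨C, hC⟩ := (isCompact_univ.image hv).isBounded.exists_norm_le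
  exact Integrable.of_bound hv.aestronglyMeasurable C
    (Filter.Eventually.of_forall fun x => hC _ ⟨x, trivial, rfl⟩)

/-- Termwise integration of an absolutely convergent trigonometric series. -/
lemma hasSum_integral_series {d : ℕ} {a : ℝ} {c : (Fin d → ℤ) → ℂ} (hc : Summable fun h => ‖c h‖)
    {u v : Box a d → ℂ} (hu : ∀ x, HasSum (fun h => c h * trigProd a h x) (u x))
    (hv : Continuous v) :
    HasSum (fun h => c h * ∫ x, trigProd a h x * v x) (∫ x, u x * v x) := by
  have hcont : ∀ h, Continuous fun x => c h * trigProd a h x * v x := fun h =>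
    (continuous_const.mul (continuous_trigProd a h)).mul hv
  have key := hasSum_integral_of_summable_integral_norm
    (F := fun h x => c h * trigProd a h x * v x) (μ := (volume : Measure (Box a d)))
    (fun h => integrable_of_continuous (hcont h)) (by
      simp only [norm_mul, norm_trigProd, mul_assoc, integral_const_mul]
      exact hc.mul_right _)
  simp only [tsum_mul_right, (hu _).tsum_eq] at key
  simpa only [mul_assoc, integral_const_mul] using key

/-- Integrating the series against one basis function isolates its coefficient by orthonormality.
This identifies the Fourier coefficients of the kernel sections. -/
lemma coeff_eq_of_hasSum {d : ℕ} {a : ℝ} (ha : 0 < a) {c : (Fin d → ℤ) → ℂ}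
    (hc : Summable fun h => ‖c h‖) {f : Box a d → ℝ}
    (hf : ∀ x, HasSum (fun h => c h * trigProd a h x) (f x : ℂ)) (k : Fin d → ℤ) :
    coeff f k = c k := by
  have h1 := hasSum_integral_series hc hf (v := fun x => conj (trigProd a k x))
    (Complex.continuous_conj.comp (continuous_trigProd a k))
  simp only [integral_trigProd_mul_conj ha] at h1
  refine h1.unique ?_
  simpa using hasSum_single (f := fun h => c h * if h = k then 1 else 0) k
    fun h hk => by simp [hk]

lemma summable_norm_coeff {d : ℕ} {a : ℝ} (ha : 0 < a) {f : Box a d → ℝ}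
    (hf : HasFourierSeries f) : Summable fun h => ‖coeff f h‖ := by
  have hx : (fun _ : Fin d => -a) ∈ Set.Icc (fun _ : Fin d => -a) (fun _ : Fin d => a) :=
    ⟨le_rfl, fun _ => by simp only; linarith⟩
  have := (hf ⟨_, hx⟩).summable.norm
  simp only [norm_mul, norm_trigProd] at this
  exact (summable_mul_right_iff (by positivity)).1 this

/-- Parseval's identity. -/
lemma hasSum_norm_sq_coeff {d : ℕ} {a : ℝ} (ha : 0 < a) {f : Box a d → ℝ}
    (hf : HasFourierSeries f) : HasSum (fun h => ‖coeff f h‖ ^ 2) (∫ x, f x ^ 2) := by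
  have hfc : Continuous fun x => (f x : ℂ) := Complex.continuous_ofReal.comp hf.continuous
  -- Integrating the series of f termwise against f itself gives Parseval directly, without
  -- completeness of the basis.
  have h1 := hasSum_integral_series (summable_norm_coeff ha hf) hf hfc
  have h2 : ∀ h, coeff f h * ∫ x, trigProd a h x * f x = ((‖coeff f h‖ ^ 2 : ℝ) : ℂ) := by
    intro h
    have : ∫ x, trigProd a h x * f x = conj (coeff f h) := by
      rw [coeff, ← integral_conj]
      simp [mul_comm]
    rw [this, Complex.mul_conj, Complex.normSq_eq_norm_sq]
  have h3 : ∫ x, (f x : ℂ) * f x = ((∫ x, f x ^ 2 : ℝ) : ℂ) := by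
    rw [← integral_complex_ofReal]
    simp [sq]
  simp only [h2, h3] at h1
  exact_mod_cast h1

/-! ### Weights -/

lemma weight₁_pos (α : ℕ) {a : ℝ} (ha : 0 < a) (h : ℤ) : 0 < weight₁ α a h := by
  unfold weight₁
  split_ifs with h0
  · positivity
  · have : (h : ℝ) ≠ 0 := by exact_mod_cast h0
    have := Real.pi_pos
    positivity

lemma weight_pos {d : ℕ} (α : ℕ) {a : ℝ} (ha : 0 < a) (h : Fin d → ℤ) : 0 < weight α a h :=
  Finset.prod_pos fun j _ => weight₁_pos α ha (h j)

lemma weight_neg {d : ℕ} (α : ℕ) (a : ℝ) (h : Fin d → ℤ) : weight α a (-h) = weight α a h := by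
  simp [weight, weight₁, neg_div, abs_neg]

/-- For h ≠ 0 this is an equality by scaling. At h = 0 it needs 2a ≥ 1, the only place where the
size of a matters for the comparison. -/
lemma weight₁_half_le (α : ℕ) {a : ℝ} (ha : 1 / 2 ≤ a) (h : ℤ) :
    weight₁ α (1 / 2) h ≤ (2 * a) ^ α * weight₁ α a h := by
  unfold weight₁
  split_ifs with h0
  · have h1 : (1 : ℝ) ≤ (2 * a) ^ α := one_le_pow₀ (by linarith)
    have h2 : 1 ≤ Real.sqrt (2 * a) := Real.one_le_sqrt.2 (by linarith)
    rw [mul_one_div_cancel two_ne_zero, Real.sqrt_one]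
    exact one_le_mul_of_one_le_of_one_le h1 h2
  · have ha0 : 0 < a := by linarith
    rw [← mul_pow, ← abs_of_pos (by positivity : 0 < 2 * a), ← abs_mul]
    apply le_of_eq
    congr 2
    field_simp

lemma weight_half_le {d : ℕ} (α : ℕ) {a : ℝ} (ha : 1 / 2 ≤ a) (h : Fin d → ℤ) :
    weight α (1 / 2) h ≤ (2 * a) ^ (α * d) * weight α a h := by
  calc weight α (1 / 2) h ≤ ∏ j, (2 * a) ^ α * weight₁ α a (h j) :=
        Finset.prod_le_prod (fun j _ => (weight₁_pos α (by norm_num) (h j)).le)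
          fun j _ => weight₁_half_le α ha (h j)
    _ = _ := by
        rw [Finset.prod_mul_distrib, Finset.prod_const, Finset.card_univ, Fintype.card_fin, pow_mul]
        rfl

lemma summable_inv_weight_half_sq {α : ℕ} (hα : 1 ≤ α) (d : ℕ) :
    Summable fun h : Fin d → ℤ => (weight α (1 / 2) h ^ 2)⁻¹ := by
  have hα' : (1 : ℝ) ≤ α := by exact_mod_cast hα
  have h1 : ∀ h : Fin d → ℤ, (weight α (1 / 2) h ^ 2)⁻¹ = ∏ j, rho (2 * α) (h j) := by
    intro h
    simp only [weight, ← Finset.prod_pow, ← Finset.prod_inv_distrib, inv_weight₁_sq]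
  have h2 : ∑' h : Fin d → ℤ, ENNReal.ofReal (∏ j, rho (2 * α) (h j)) ≠ ⊤ := by
    simp only [ENNReal.ofReal_prod_of_nonneg fun j _ => (rho_pos _ _).le]
    rw [tsum_pi_prod fun _ h => ENNReal.ofReal (rho (2 * α) h)]
    simp only [tsum_rho (by linarith : (1 : ℝ) < 2 * α)]
    exact ENNReal.prod_ne_top fun _ _ => ENNReal.ofReal_ne_top
  have h3 := ENNReal.summable_toReal h2
  simp only [h1]
  simpa only [ENNReal.toReal_ofReal (Finset.prod_nonneg fun j _ => (rho_pos (2 * α) _).le)] using h3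

lemma summable_inv_weight_sq {α : ℕ} (hα : 1 ≤ α) (d : ℕ) {a : ℝ} (ha : 1 / 2 ≤ a) :
    Summable fun h : Fin d → ℤ => (weight α a h ^ 2)⁻¹ := by
  refine ((summable_inv_weight_half_sq hα d).mul_left (((2 * a) ^ (α * d)) ^ 2)).of_nonneg_of_le
    (fun h => by positivity) fun h => ?_
  have ha0 : 0 < a := by linarith
  have h1 := weight_pos α ha0 h
  have h2 := weight_pos α (by norm_num : (0 : ℝ) < 1 / 2) h
  have h3 := weight_half_le α ha h
  rw [← div_eq_mul_inv, inv_eq_one_div, div_le_div_iff₀ (by positivity) (by positivity), one_mul,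
    ← mul_pow]
  gcongr

/-! ### The reproducing kernel -/

lemma trigProd_neg {d : ℕ} (a : ℝ) (h : Fin d → ℤ) (x : Box a d) :
    trigProd a (-h) x = conj (trigProd a h x) := by
  unfold trigProd trig
  rw [map_prod]
  refine Finset.prod_congr rfl fun j _ => ?_
  rw [map_mul, Complex.conj_ofReal, ← Complex.exp_conj, map_mul, Complex.conj_ofReal,
    Complex.conj_I]
  congr 2
  push_cast [Pi.neg_apply]
  ring

/-- The terms at h and −h are conjugate, so the sum is real and taking the real part in `kernel`
loses nothing. Conjugating the series turns it into a Fourier series in y. -/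
lemma hasSum_kernel {d α : ℕ} (hα : 1 ≤ α) {a : ℝ} (ha : 1 / 2 ≤ a) (x y : Box a d) :
    HasSum (fun h => (((weight α a h ^ 2)⁻¹ : ℝ) : ℂ) * conj (trigProd a h x) * trigProd a h y)
      (kernel α a x y : ℂ) := by
  set t : (Fin d → ℤ) → ℂ := fun h => (((weight α a h ^ 2)⁻¹ : ℝ) : ℂ) * trigProd a h x *
    conj (trigProd a h y) with ht
  have hsum : Summable t := by
    refine Summable.of_norm ?_
    have : ∀ h, ‖t h‖ = (weight α a h ^ 2)⁻¹ * ((1 / Real.sqrt (2 * a)) ^ d *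
        (1 / Real.sqrt (2 * a)) ^ d) := by
      intro h
      simp only [ht, norm_mul, RCLike.norm_conj, norm_trigProd, Complex.norm_real]
      rw [Real.norm_of_nonneg (by positivity), mul_assoc]
    simp only [this]
    exact (summable_inv_weight_sq hα d ha).mul_right _
  have hneg : ∀ h, t (-h) = conj (t h) := by
    intro h
    simp only [ht, trigProd_neg, weight_neg, map_mul, Complex.conj_ofReal]
  have hs := hsum.hasSum
  have hconj : HasSum (fun h => conj (t h)) (conj (∑' h, t h)) := hs.map (starRingEnd ℂ)
    Complex.continuous_conj
  have hreal : conj (∑' h, t h) = ∑' h, t h := by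
    have h1 : HasSum (fun h => conj (t h)) (∑' h, t h) := by
      simpa only [Function.comp_def, Equiv.neg_apply, hneg] using
        (Equiv.neg (Fin d → ℤ)).hasSum_iff.2 hs
    exact hconj.unique h1
  have hk : (kernel α a x y : ℂ) = conj (∑' h, t h) := by
    rw [hreal]
    exact Complex.conj_eq_iff_re.1 hreal
  rw [hk]
  convert! hconj using 2 with h
  simp [ht]

lemma coeff_kernel {d α : ℕ} (hα : 1 ≤ α) {a : ℝ} (ha : 1 / 2 ≤ a) (x : Box a d)
    (h : Fin d → ℤ) :
    coeff (kernel α a x) h = (((weight α a h ^ 2)⁻¹ : ℝ) : ℂ) * conj (trigProd a h x) := by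
  refine coeff_eq_of_hasSum (by linarith)
    (c := fun h => (((weight α a h ^ 2)⁻¹ : ℝ) : ℂ) * conj (trigProd a h x)) ?_
    (hasSum_kernel hα ha x) h
  simp only [norm_mul, RCLike.norm_conj, norm_trigProd, Complex.norm_real]
  refine Summable.mul_right _ ?_
  simpa using (summable_inv_weight_sq hα d ha).norm

lemma kernel_mem {d α : ℕ} (hα : 1 ≤ α) {a : ℝ} (ha : 1 / 2 ≤ a) (x : Box a d) :
    kernel α a x ∈ korobovSubmodule α a d := by
  refine ⟨fun y => ?_, ?_⟩
  · simpa only [coeff_kernel hα ha] using hasSum_kernel hα ha x y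
  · simp only [coeff_kernel hα ha, norm_mul, RCLike.norm_conj, norm_trigProd, Complex.norm_real]
    refine ((summable_inv_weight_sq hα d ha).mul_right
      (((1 / Real.sqrt (2 * a)) ^ d) ^ 2)).congr fun h => ?_
    have := weight_pos α (by linarith : 0 < a) h
    rw [Real.norm_of_nonneg (by positivity)]
    field_simp

/-- The kernel section `K(x, ·)` as an element of the Korobov space. -/
def kernelSection {d α : ℕ} (hα : 1 ≤ α) {a : ℝ} (ha : 1 / 2 ≤ a) (x : Box a d) :
    KorobovSpace α a d := ⟨kernel α a x, kernel_mem hα ha x⟩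

lemma toFun_kernelSection {d α : ℕ} (hα : 1 ≤ α) {a : ℝ} (ha : 1 / 2 ≤ a) (x : Box a d) :
    toFun (kernelSection hα ha x) = kernel α a x := rfl

/-- The reproducing property. -/
lemma inner_kernelSection {d α : ℕ} (hα : 1 ≤ α) {a : ℝ} (ha : 1 / 2 ≤ a)
    (f : KorobovSpace α a d) (x : Box a d) :
    inner ℝ f (kernelSection hα ha x) = f x := by
  change innerK f (kernelSection hα ha x) = f x
  unfold innerK
  have hx : HasSum (fun h => coeff (toFun f) h * trigProd a h x) ((f x : ℝ) : ℂ) := f.2.1 x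
  rw [← Complex.ofReal_re (f x), ← hx.tsum_eq]
  congr 2
  funext h
  have hw := weight_pos α (by linarith : 0 < a) h
  have hw' : (weight α a h : ℂ) ≠ 0 := by exact_mod_cast hw.ne'
  rw [toFun_kernelSection, coeff_kernel hα ha, map_mul, Complex.conj_conj, Complex.conj_ofReal]
  push_cast
  field_simp

/-! ### Orthogonal projection and interpolation -/

lemma kernelSpan_eq_span {ι : Type*} {d α : ℕ} (hα : 1 ≤ α) {a : ℝ} (ha : 1 / 2 ≤ a)
    (X : ι → Box a d) :
    kernelSpan α X = Submodule.span ℝ (Set.range fun k => kernelSection hα ha (X k)) := by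
  have h1 : Set.range (fun k => kernel α a (X k)) =
      toFun '' Set.range fun k => kernelSection hα ha (X k) := by
    rw [← Set.range_comp]
    rfl
  rw [kernelSpan, h1, ← Submodule.map_span, Submodule.comap_map_eq_of_injective toFun_injective]

/-- The elements orthogonal to `V_N(X)` are those vanishing on `X`. -/
lemma mem_orthogonal_kernelSpan {ι : Type*} {d α : ℕ} (hα : 1 ≤ α) {a : ℝ} (ha : 1 / 2 ≤ a)
    (X : ι → Box a d) (f : KorobovSpace α a d) :
    f ∈ (kernelSpan α X)ᗮ ↔ ∀ k, f (X k) = 0 := by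
  rw [kernelSpan_eq_span hα ha, Submodule.mem_orthogonal']
  constructor
  · intro h k
    rw [← inner_kernelSection hα ha]
    exact h _ (Submodule.subset_span ⟨k, rfl⟩)
  · intro h u hu
    induction hu using Submodule.span_induction with
    | mem u hu =>
      obtain ⟨k, rfl⟩ := hu
      rw [inner_kernelSection hα ha]
      exact h k
    | zero => exact inner_zero_right _
    | add u v _ _ hu hv => rw [inner_add_right, hu, hv, add_zero]
    | smul c u _ hu => rw [inner_smul_right, hu, mul_zero]

lemma sub_proj_apply {ι : Type*} [Finite ι] {d α : ℕ} (hα : 1 ≤ α) {a : ℝ} (ha : 1 / 2 ≤ a)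
    (X : ι → Box a d) (φ : KorobovSpace α a d) (k : ι) : (φ - proj α X φ) (X k) = 0 :=
  (mem_orthogonal_kernelSpan hα ha X _).1 (Submodule.sub_starProjection_mem_orthogonal φ) k

/-- The orthogonal projection is the unique kernel interpolant. -/
lemma interpolates_iff_eq_proj {ι : Type*} [Finite ι] {d α : ℕ} (hα : 1 ≤ α) {a : ℝ}
    (ha : 1 / 2 ≤ a) (X : ι → Box a d) (φ : KorobovSpace α a d) {v : KorobovSpace α a d}
    (hv : v ∈ kernelSpan α X) : (∀ k, v (X k) = φ (X k)) ↔ v = proj α X φ := by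
  constructor
  · intro h
    have h0 : φ - v ∈ (kernelSpan α X)ᗮ := by
      rw [mem_orthogonal_kernelSpan hα ha]
      intro k
      rw [map_sub, Pi.sub_apply, h k, sub_self]
    exact (Submodule.eq_starProjection_of_mem_orthogonal hv h0).symm
  · rintro rfl k
    have := sub_proj_apply hα ha X φ k
    rw [map_sub, Pi.sub_apply] at this
    linarith

lemma norm_sub_proj_le {ι : Type*} [Finite ι] {d α : ℕ} {a : ℝ}
    (X : ι → Box a d) (φ : KorobovSpace α a d) : ‖φ - proj α X φ‖ ≤ ‖φ‖ := by
  have h := Submodule.norm_sq_eq_add_norm_sq_starProjection φ (kernelSpan α X)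
  rw [Submodule.starProjection_orthogonal_val] at h
  refine (sq_le_sq₀ (norm_nonneg _) (norm_nonneg _)).1 ?_
  rw [h]
  exact le_add_of_nonneg_left (sq_nonneg _)

/-! ### Aliasing on the lattice -/

/-- Replacing the fractional part of t by t changes the phase by the integer multiple h⌊t⌋ of 2πi.
-/
lemma trig_lattice {a : ℝ} (ha : 0 < a) (h : ℤ) (t : ℝ) :
    trig a h (2 * a * Int.fract t - a) = ((1 / Real.sqrt (2 * a) : ℝ) : ℂ) *
      Complex.exp (2 * Real.pi * Complex.I * (h * t)) := by
  unfold trig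
  congr 1
  rw [Complex.exp_eq_exp_iff_exists_int]
  refine ⟨-(h * ⌊t⌋), ?_⟩
  rw [show (2 * a * Int.fract t - a + a) / (2 * a) = t - ⌊t⌋ by
    rw [sub_add_cancel, mul_div_cancel_left₀ _ (by positivity), Int.fract]]
  push_cast
  ring

lemma trigProd_lattice {d N : ℕ} {a : ℝ} (ha : 0 < a) (z : Fin d → ℕ) (k : Fin N)
    (h : Fin d → ℤ) :
    trigProd a h (scaledLattice a ha.le N z k) = ((1 / Real.sqrt (2 * a) : ℝ) : ℂ) ^ d *
      (Complex.exp (2 * Real.pi * Complex.I / N) ^ (∑ j, h j * (z j : ℤ))) ^ ((k : ℕ) + 1) := by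
  simp only [trigProd, scaledLattice, trig_lattice ha, Finset.prod_mul_distrib, Finset.prod_const,
    Finset.card_univ, Fintype.card_fin]
  rw [← Complex.exp_sum, ← Complex.exp_int_mul, ← Complex.exp_nat_mul]
  congr 2
  push_cast
  rw [Finset.sum_mul, Finset.mul_sum]
  refine Finset.sum_congr rfl fun j _ => ?_
  ring

lemma sum_rootOfUnity_pow {N : ℕ} (hN : N ≠ 0) (m : ℤ) :
    ∑ k : Fin N, (Complex.exp (2 * Real.pi * Complex.I / N) ^ m) ^ ((k : ℕ) + 1) =
      if (N : ℤ) ∣ m then (N : ℂ) else 0 := by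
  have hz := Complex.isPrimitiveRoot_exp N hN
  split_ifs with hm
  · simp [(hz.zpow_eq_one_iff_dvd m).2 hm]
  · set η := Complex.exp (2 * Real.pi * Complex.I / N) ^ m with hη
    have h1 : η ≠ 1 := fun h => hm ((hz.zpow_eq_one_iff_dvd m).1 h)
    have hN1 : η ^ N = 1 := by
      rw [hη, ← zpow_natCast, zpow_comm, zpow_natCast, hz.pow_eq_one, one_zpow]
    rw [Fin.sum_univ_eq_sum_range (fun k => η ^ (k + 1))]
    simp only [pow_succ]
    rw [← Finset.sum_mul, geom_sum_eq h1, hN1, sub_self, zero_div, zero_mul]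

open Classical in
/-- The Fourier coefficients of a function vanishing on the lattice points sum to zero over every
coset of the dual lattice. -/
lemma hasSum_coeff_dual {d N : ℕ} (hN : N ≠ 0) {a : ℝ} (ha : 0 < a) (z : Fin d → ℕ)
    {g : Box a d → ℝ} (hg : HasFourierSeries g)
    (h0 : ∀ k, g (scaledLattice a ha.le N z k) = 0) (h : Fin d → ℤ) :
    HasSum (fun l => if InDual N z l then coeff g (h + l) else 0) 0 := by
  set C : ℂ := ((1 / Real.sqrt (2 * a) : ℝ) : ℂ) ^ d with hC
  have hC0 : C ≠ 0 := by
    have : (1 / Real.sqrt (2 * a) : ℝ) ≠ 0 := by positivity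
    exact pow_ne_zero _ (by exact_mod_cast this)
  have hN0 : (N : ℂ) ≠ 0 := by exact_mod_cast hN
  set ζ := Complex.exp (2 * Real.pi * Complex.I / N) with hζ
  have hζ0 : ζ ≠ 0 := Complex.exp_ne_zero _
  have h1 : ∀ k : Fin N, HasSum (fun l => coeff g (h + l) *
      (C * (ζ ^ (∑ j, l j * (z j : ℤ))) ^ ((k : ℕ) + 1))) 0 := by
    intro k
    have h2 := hg (scaledLattice a ha.le N z k)
    rw [h0 k, Complex.ofReal_zero] at h2
    -- The series at the k-th point is reindexed by h + ℓ and divided by the phase of h, leaving the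
    -- phase of ℓ alone.
    have h3 := ((Equiv.addLeft h).hasSum_iff.2 h2).mul_right
      (((ζ ^ (∑ j, h j * (z j : ℤ))) ^ ((k : ℕ) + 1))⁻¹)
    rw [zero_mul] at h3
    convert! h3 using 2 with l
    simp only [Function.comp_apply, Equiv.coe_addLeft, trigProd_lattice ha, Pi.add_apply, add_mul,
      Finset.sum_add_distrib]
    rw [← hζ, ← hC, zpow_add₀ hζ0, mul_pow]
    have : (ζ ^ (∑ j, h j * (z j : ℤ))) ^ ((k : ℕ) + 1) ≠ 0 := pow_ne_zero _ (zpow_ne_zero _ hζ0)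
    field_simp
  -- Summing over the points turns the phase of ℓ into N on the dual lattice and 0 off it.
  have h2 := (hasSum_sum fun k (_ : k ∈ (Finset.univ : Finset (Fin N))) => h1 k).mul_right
    ((C * N)⁻¹)
  rw [Finset.sum_const_zero, zero_mul] at h2
  convert! h2 using 2 with l
  rw [← Finset.mul_sum, ← Finset.mul_sum, sum_rootOfUnity_pow hN]
  unfold InDual
  split_ifs
  · field_simp
  · simp

/-! ### From aliasing to the L² norm -/

/-- Cauchy-Schwarz for series of nonnegative terms. -/
lemma tsum_mul_sq_le {ι : Type*} {f g : ι → ℝ} (hf : ∀ i, 0 ≤ f i) (hg : ∀ i, 0 ≤ g i)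
    (hf2 : Summable fun i => f i ^ 2) (hg2 : Summable fun i => g i ^ 2) :
    (∑' i, f i * g i) ^ 2 ≤ (∑' i, f i ^ 2) * ∑' i, g i ^ 2 := by
  have h := Real.inner_le_Lp_mul_Lq_tsum_of_nonneg Real.HolderConjugate.two_two hf hg
    (by simpa using hf2) (by simpa using hg2)
  simp only [Real.rpow_two, ← Real.sqrt_eq_rpow] at h
  have hF : 0 ≤ ∑' i, f i ^ 2 := tsum_nonneg fun i => sq_nonneg _
  have hG : 0 ≤ ∑' i, g i ^ 2 := tsum_nonneg fun i => sq_nonneg _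
  calc (∑' i, f i * g i) ^ 2 ≤ (Real.sqrt (∑' i, f i ^ 2) * Real.sqrt (∑' i, g i ^ 2)) ^ 2 :=
        pow_le_pow_left₀ (tsum_nonneg fun i => mul_nonneg (hf i) (hg i)) h 2
    _ = _ := by rw [mul_pow, Real.sq_sqrt hF, Real.sq_sqrt hG]

-- The aliasing identity expresses ĝ(h) as minus the sum of ĝ(h+ℓ) over nonzero dual ℓ;
-- Cauchy-Schwarz is applied after inserting r(h+ℓ)·r(h+ℓ)^{-1}.
open Classical in
lemma norm_coeff_sq_le {d α N : ℕ} (hα : 1 ≤ α) (hN : N ≠ 0) {a : ℝ} (ha : 0 < a)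
    (z : Fin d → ℕ) {g : Box a d → ℝ} (hg : HasFourierSeries g)
    (h0 : ∀ k, g (scaledLattice a ha.le N z k) = 0)
    (hs : Summable fun h => ‖coeff g h‖ ^ 2 * weight α (1 / 2) h ^ 2) (h : Fin d → ℤ) :
    ENNReal.ofReal (‖coeff g h‖ ^ 2) ≤
      ENNReal.ofReal (∑' k, ‖coeff g k‖ ^ 2 * weight α (1 / 2) k ^ 2) *
        ∑' l, if l ≠ 0 ∧ InDual N z l then
          ENNReal.ofReal ((weight α (1 / 2) (h + l) ^ 2)⁻¹) else 0 := by
  have hw : ∀ k : Fin d → ℤ, 0 < weight α (1 / 2) k := weight_pos α (by norm_num)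
  set f : (Fin d → ℤ) → ℝ := fun l => ‖coeff g (h + l)‖ * weight α (1 / 2) (h + l) with hf
  set u : (Fin d → ℤ) → ℝ := fun l =>
    if l ≠ 0 ∧ InDual N z l then (weight α (1 / 2) (h + l))⁻¹ else 0 with hu
  have hf2 : HasSum (fun l => f l ^ 2) (∑' k, ‖coeff g k‖ ^ 2 * weight α (1 / 2) k ^ 2) := by
    have := (Equiv.addLeft h).hasSum_iff.2 hs.hasSum
    simpa only [hf, mul_pow, Function.comp_def, Equiv.coe_addLeft] using this
  have hu2 : ∀ l, u l ^ 2 =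
      if l ≠ 0 ∧ InDual N z l then (weight α (1 / 2) (h + l) ^ 2)⁻¹ else 0 := by
    intro l
    simp only [hu]
    split_ifs
    · rw [inv_pow]
    · simp
  have hu0 : ∀ l, 0 ≤ u l := by
    intro l
    simp only [hu]
    split_ifs
    exacts [(inv_pos.2 (hw _)).le, le_rfl]
  have husum : Summable fun l => u l ^ 2 := by
    refine ((Equiv.addLeft h).summable_iff.2 (summable_inv_weight_half_sq hα d)).of_nonneg_of_le
      (fun l => sq_nonneg _) fun l => ?_
    rw [hu2]
    split_ifs
    · rfl
    · have := hw (h + l)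
      simp only [Function.comp_apply, Equiv.coe_addLeft]
      positivity
  have hfu : ∀ l, f l * u l = if l = 0 then 0 else ‖if InDual N z l then coeff g (h + l) else 0‖ := by
    intro l
    have := (hw (h + l)).ne'
    simp only [hf, hu]
    by_cases hl : l = 0
    · simp [hl]
    · by_cases hd : InDual N z l
      · simp only [hl, hd, ne_eq, not_false_eq_true, and_self, if_true, if_false]
        field_simp
      · simp [hl, hd]
  have hle : ‖coeff g h‖ ≤ ∑' l, f l * u l := by
    have hsum := hasSum_coeff_dual hN ha z hg h0 h
    have h1 := hsum.summable.tsum_eq_add_tsum_ite (0 : Fin d → ℤ)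
    have hd0 : InDual N z (0 : Fin d → ℤ) := by simp [InDual]
    rw [hsum.tsum_eq, if_pos hd0, add_zero] at h1
    have hnorm : Summable fun l => f l * u l := by
      refine hsum.summable.norm.of_nonneg_of_le
        (fun l => mul_nonneg (mul_nonneg (norm_nonneg _) (hw _).le) (hu0 l)) fun l => ?_
      rw [hfu]
      split_ifs <;> simp
    rw [eq_neg_of_add_eq_zero_left h1.symm, norm_neg]
    have heq : ∀ l, f l * u l =
        ‖if l = 0 then 0 else if InDual N z l then coeff g (h + l) else 0‖ := by
      intro l
      rw [hfu]
      by_cases hl : l = 0 <;> simp [hl]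
    simp only [heq] at hnorm ⊢
    exact norm_tsum_le_tsum_norm hnorm
  have hCS := tsum_mul_sq_le (fun l => mul_nonneg (norm_nonneg _) (hw (h + l)).le) hu0
    hf2.summable husum
  rw [hf2.tsum_eq] at hCS
  calc ENNReal.ofReal (‖coeff g h‖ ^ 2)
      ≤ ENNReal.ofReal ((∑' k, ‖coeff g k‖ ^ 2 * weight α (1 / 2) k ^ 2) * ∑' l, u l ^ 2) :=
        ENNReal.ofReal_le_ofReal ((pow_le_pow_left₀ (norm_nonneg _) hle 2).trans hCS)
    _ = _ := by
        rw [ENNReal.ofReal_mul (tsum_nonneg fun k => by positivity),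
          ENNReal.ofReal_tsum_of_nonneg (fun l => sq_nonneg _) husum]
        simp only [hu2, apply_ite ENNReal.ofReal, ENNReal.ofReal_zero]

/-- Frequencies are split at r(h)² = M. Large weights are controlled by G directly; for small ones
the aliasing bound is multiplied by M·r(h)^{-2} ≥ 1, which completes the summand of the criterion.
-/
lemma tsum_norm_coeff_sq_le {d α N : ℕ} (hα : 1 ≤ α) (hN : N ≠ 0) {a : ℝ} (ha : 0 < a)
    (z : Fin d → ℕ) {g : Box a d → ℝ} (hg : HasFourierSeries g)
    (h0 : ∀ k, g (scaledLattice a ha.le N z k) = 0)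
    (hs : Summable fun h => ‖coeff g h‖ ^ 2 * weight α (1 / 2) h ^ 2) {M : ℝ} (hM : 0 < M) :
    ∑' h, ENNReal.ofReal (‖coeff g h‖ ^ 2) ≤
      ENNReal.ofReal ((∑' k, ‖coeff g k‖ ^ 2 * weight α (1 / 2) k ^ 2) / M) +
        ENNReal.ofReal ((∑' k, ‖coeff g k‖ ^ 2 * weight α (1 / 2) k ^ 2) * M) *
          dualSum α N z := by
  classical
  have hw : ∀ k : Fin d → ℤ, 0 < weight α (1 / 2) k := weight_pos α (by norm_num)
  set G := ∑' k, ‖coeff g k‖ ^ 2 * weight α (1 / 2) k ^ 2 with hG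
  have hG0 : 0 ≤ G := tsum_nonneg fun k => by positivity
  rw [dualSum, ENNReal.tsum_prod', ← ENNReal.tsum_mul_left, hG, ← tsum_div_const,
    ENNReal.ofReal_tsum_of_nonneg (fun k => by positivity) (hs.div_const M), ← hG,
    ← ENNReal.tsum_add]
  refine ENNReal.tsum_le_tsum fun h => ?_
  rcases le_or_gt (weight α (1 / 2) h ^ 2) M with hle | hlt
  · refine le_trans ?_ le_add_self
    refine (norm_coeff_sq_le hα hN ha z hg h0 hs h).trans ?_
    rw [← hG, ENNReal.ofReal_mul hG0, mul_assoc, ← ENNReal.tsum_mul_left (a := ENNReal.ofReal M)]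
    gcongr with l
    split_ifs
    · rw [← ENNReal.ofReal_mul hM.le]
      refine ENNReal.ofReal_le_ofReal ?_
      simp only [critTerm]
      have h1 := hw h
      have h2 := hw (h + l)
      rw [mul_inv, ← mul_assoc]
      refine le_mul_of_one_le_left (by positivity) ?_
      rw [← div_eq_mul_inv, one_le_div (by positivity)]
      exact hle
    · simp
  · refine le_trans (ENNReal.ofReal_le_ofReal ?_) le_self_add
    rw [le_div_iff₀ hM]
    gcongr

/-- The `L²` norm of a function vanishing on the lattice points. -/
lemma integral_sq_le {d α N : ℕ} (hα : 1 ≤ α) (hN : N ≠ 0) {a : ℝ} (ha : 0 < a)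
    (z : Fin d → ℕ) {g : Box a d → ℝ} (hg : HasFourierSeries g)
    (h0 : ∀ k, g (scaledLattice a ha.le N z k) = 0)
    (hs : Summable fun h => ‖coeff g h‖ ^ 2 * weight α (1 / 2) h ^ 2) {R : ℝ} (hR : 0 < R)
    (hS : dualSum α N z ≤ ENNReal.ofReal (R ^ 2)) :
    ∫ x, g x ^ 2 ≤ 2 * R * ∑' k, ‖coeff g k‖ ^ 2 * weight α (1 / 2) k ^ 2 := by
  -- The threshold M = 1/R balances the two parts: each is at most R·G.
  have h1 := tsum_norm_coeff_sq_le hα hN ha z hg h0 hs (inv_pos.2 hR)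
  have hP := hasSum_norm_sq_coeff ha hg
  set G := ∑' k, ‖coeff g k‖ ^ 2 * weight α (1 / 2) k ^ 2 with hG
  have hG0 : 0 ≤ G := tsum_nonneg fun k => by positivity
  rw [← ENNReal.ofReal_tsum_of_nonneg (fun h => by positivity) hP.summable, hP.tsum_eq] at h1
  have h2 : ENNReal.ofReal (∫ x, g x ^ 2) ≤ ENNReal.ofReal (2 * R * G) := by
    refine h1.trans ((add_le_add le_rfl (mul_le_mul' le_rfl hS)).trans_eq ?_)
    rw [← ENNReal.ofReal_mul (by positivity), ← ENNReal.ofReal_add (by positivity) (by positivity)]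
    congr 1
    field_simp
    ring
  exact (ENNReal.ofReal_le_ofReal_iff (by positivity)).1 h2

lemma sum_norm_coeff_sq_weight_half_le {d α : ℕ} {a : ℝ} (ha : 1 / 2 ≤ a)
    (g : KorobovSpace α a d) :
    Summable (fun h => ‖coeff g h‖ ^ 2 * weight α (1 / 2) h ^ 2) ∧
      ∑' h, ‖coeff g h‖ ^ 2 * weight α (1 / 2) h ^ 2 ≤ ((2 * a) ^ (α * d) * ‖g‖) ^ 2 := by
  have hs : Summable fun h => ‖coeff g h‖ ^ 2 * weight α a h ^ 2 := g.2.2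
  have hle : ∀ h : Fin d → ℤ, ‖coeff g h‖ ^ 2 * weight α (1 / 2) h ^ 2 ≤
      ((2 * a) ^ (α * d)) ^ 2 * (‖coeff g h‖ ^ 2 * weight α a h ^ 2) := by
    intro h
    have h1 := pow_le_pow_left₀ (weight_pos α (by norm_num) h).le (weight_half_le α ha h) 2
    rw [mul_pow] at h1
    calc _ ≤ ‖coeff g h‖ ^ 2 * (((2 * a) ^ (α * d)) ^ 2 * weight α a h ^ 2) := by gcongr
      _ = _ := by ring
  have hs' := (hs.mul_left (((2 * a) ^ (α * d)) ^ 2)).of_nonneg_of_le (fun h => by positivity) hle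
  refine ⟨hs', (hs'.tsum_le_tsum hle (hs.mul_left _)).trans_eq ?_⟩
  rw [tsum_mul_left, ← innerK_self, mul_pow _ ‖g‖, ← real_inner_self_eq_norm_sq]
  rfl

/-! ### The constant -/

/-- `∑_u max(|u|,1) ω^{|u|}`. -/
def subsetSum (d : ℕ) (w : ℝ) : ℝ :=
  ∑ u : Finset (Fin d), ((max u.card 1 : ℕ) : ℝ) * w ^ u.card

lemma pow_le_subsetSum (d : ℕ) {w : ℝ} (hw : 0 ≤ w) : (1 + w) ^ d ≤ subsetSum d w := by
  have h := Fintype.sum_pow_mul_eq_add_pow (Fin d) w 1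
  rw [Fintype.card_fin, add_comm w 1] at h
  rw [← h]
  refine Finset.sum_le_sum fun u _ => ?_
  rw [one_pow, mul_one]
  refine le_mul_of_one_le_left (by positivity) ?_
  exact_mod_cast le_max_right _ _

/-- The left side equals ∑_u |u| w^{|u|}: the subsets containing a given j contribute w(1+w)^{d−1},
and each u is counted once for each of its elements. This is what absorbs the factor d. -/
lemma mul_pow_le_subsetSum (d : ℕ) {w : ℝ} (hw : 0 ≤ w) :
    d * w * (1 + w) ^ (d - 1) ≤ subsetSum d w := by
  have h1 : ∀ j : Fin d, w * (1 + w) ^ (d - 1) =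
      ∑ u : Finset (Fin d), if j ∈ u then w ^ u.card else 0 := by
    intro j
    -- The second summand vanishes at j, so expanding the product keeps exactly the subsets
    -- containing j.
    have h2 := Finset.prod_add (fun _ : Fin d => w) (fun i => if i = j then 0 else 1) Finset.univ
    rw [← Finset.mul_prod_erase _ _ (Finset.mem_univ j), if_pos rfl, add_zero,
      Finset.prod_congr rfl (g := fun _ => 1 + w) (by
        intro i hi
        rw [if_neg (Finset.ne_of_mem_erase hi), add_comm]),
      Finset.prod_const, Finset.card_erase_of_mem (Finset.mem_univ j), Finset.card_univ,
      Fintype.card_fin, Finset.powerset_univ] at h2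
    rw [h2]
    refine Finset.sum_congr rfl fun u _ => ?_
    rw [Finset.prod_const]
    split_ifs with hj
    · rw [Finset.prod_eq_one, mul_one]
      intro i hi
      rw [if_neg]
      rintro rfl
      simp [hj] at hi
    · have hz : ∏ i ∈ Finset.univ \ u, (if i = j then (0 : ℝ) else 1) = 0 :=
        Finset.prod_eq_zero (i := j) (by simpa using hj) (if_pos rfl)
      rw [hz, mul_zero]
  calc d * w * (1 + w) ^ (d - 1) = ∑ _j : Fin d, w * (1 + w) ^ (d - 1) := by
        simp [mul_assoc]
    _ = ∑ u : Finset (Fin d), (u.card : ℝ) * w ^ u.card := by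
        rw [Finset.sum_congr rfl fun j _ => h1 j, Finset.sum_comm]
        refine Finset.sum_congr rfl fun u _ => ?_
        simp
    _ ≤ _ := by
        refine Finset.sum_le_sum fun u _ => ?_
        gcongr
        exact le_max_left _ _

lemma errorConst_eq (α : ℕ) (δ : ℝ) (d : ℕ) : errorConst α δ d = kappa α δ *
    subsetSum d (omega ((α : ℝ) / ((α : ℝ) - 2 * δ))) ^ ((α : ℝ) - 2 * δ) := rfl

lemma errorConst_nonneg (α : ℕ) (δ : ℝ) (d : ℕ) : 0 ≤ errorConst α δ d := by
  have hw := omega_nonneg ((α : ℝ) / ((α : ℝ) - 2 * δ))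
  have hQ := (pow_nonneg (add_nonneg zero_le_one hw) d).trans (pow_le_subsetSum d hw)
  rw [errorConst_eq]
  refine mul_nonneg ?_ (Real.rpow_nonneg hQ _)
  unfold kappa
  positivity

lemma averaging_bound_le {d N : ℕ} (hd : 1 ≤ d) (hN : 2 ≤ N) {b w : ℝ} (hb : 1 < b)
    (hw : 0 ≤ w) :
    (1 + w) ^ (2 * d) / ((N : ℝ) - 1) +
      d * ((1 + w) ^ (2 * (d - 1)) * (w * (2 + 2 ^ (b + 1) * w) / N)) ≤
      max 6 (5 / 2 + (2 : ℝ) ^ (2 * b + 1)) * subsetSum d w ^ 2 / N := by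
  have hN' : (2 : ℝ) ≤ N := by exact_mod_cast hN
  have hd' : (1 : ℝ) ≤ d := by exact_mod_cast hd
  have hQ1 := pow_le_subsetSum d hw
  have hQ2 := mul_pow_le_subsetSum d hw
  set Q := subsetSum d w
  set V := (1 + w) ^ (d - 1) with hV
  have hV0 : 0 ≤ V := by positivity
  have hVQ : V ≤ Q := (pow_le_pow_right₀ (by linarith) (Nat.sub_le d 1)).trans hQ1
  have hQ0 : 0 ≤ Q := hV0.trans hVQ
  have e1 : (1 + w) ^ (2 * d) ≤ Q ^ 2 := by
    rw [mul_comm, pow_mul]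
    exact pow_le_pow_left₀ (by positivity) hQ1 2
  have h2b : (2 : ℝ) ≤ 2 ^ b := by
    simpa using Real.rpow_le_rpow_of_exponent_le one_le_two hb.le
  have hb1 : (2 : ℝ) ^ (b + 1) = 2 * 2 ^ b := by
    rw [Real.rpow_add two_pos, Real.rpow_one, mul_comm]
  have hb2 : (2 : ℝ) ^ (2 * b + 1) = 2 * (2 ^ b * 2 ^ b) := by
    rw [Real.rpow_add two_pos, Real.rpow_one, two_mul, Real.rpow_add two_pos, mul_comm]
  -- The 4 collects 2 from 1/(N−1) ≤ 2/N and 2 from the correlation constant. With x = 2^b ≥ 2 the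
  -- claim is 4 + 2x ≤ 5/2 + 2x².
  have hK : 4 + (2 : ℝ) ^ (b + 1) ≤ max 6 (5 / 2 + (2 : ℝ) ^ (2 * b + 1)) := by
    refine le_trans ?_ (le_max_right _ _)
    rw [hb1, hb2]
    nlinarith
  have e2 : (1 + w) ^ (2 * d) / ((N : ℝ) - 1) ≤ 2 * Q ^ 2 / N := by
    rw [div_le_div_iff₀ (by linarith) (by linarith)]
    nlinarith [sq_nonneg Q]
  have e3 : d * ((1 + w) ^ (2 * (d - 1)) * (w * (2 + 2 ^ (b + 1) * w) / N)) ≤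
      (2 + 2 ^ (b + 1)) * Q ^ 2 / N := by
    rw [mul_comm 2 (d - 1), pow_mul, ← hV, ← mul_div_assoc, ← mul_div_assoc]
    gcongr ?_ / _
    have i1 : (d * w * V) * V ≤ Q * Q := mul_le_mul hQ2 hVQ hV0 hQ0
    have i2 : (d * w * V) * (d * w * V) ≤ Q * Q := mul_le_mul hQ2 hQ2 (by positivity) hQ0
    have i3 : d * (w * V) ^ 2 ≤ Q * Q := by
      refine le_trans ?_ i2
      have : 0 ≤ (d : ℝ) * (w * V) ^ 2 := by positivity
      nlinarith
    have i4 := mul_le_mul_of_nonneg_left i3 (by positivity : (0 : ℝ) ≤ 2 ^ (b + 1))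
    linarith
  calc _ ≤ 2 * Q ^ 2 / N + (2 + 2 ^ (b + 1)) * Q ^ 2 / N := add_le_add e2 e3
    _ = (4 + 2 ^ (b + 1)) * Q ^ 2 / N := by ring
    _ ≤ _ := by gcongr

lemma dualSum_le {d α N : ℕ} (hα : 1 ≤ α) (hd : 1 ≤ d) (hN : N.Prime) {z : Fin d → ℕ}
    (hz : IsCBCVector α N z) {δ : ℝ} (hδ : 0 < δ) (hδ' : δ ≤ (α : ℝ) / 2 - 1 / 4) :
    dualSum α N z ≤ ENNReal.ofReal (((max 6 (5 / 2 + (2 : ℝ) ^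
      (2 * (α : ℝ) / ((α : ℝ) - 2 * δ) + 1)) *
        subsetSum d (omega ((α : ℝ) / ((α : ℝ) - 2 * δ))) ^ 2 / N) ^ ((α : ℝ) - 2 * δ)) ^ 2) := by
  have hα' : (1 : ℝ) ≤ α := by exact_mod_cast hα
  have hpos : 0 < (α : ℝ) - 2 * δ := by linarith
  -- With this q the exponent 2αq is α/(α−2δ), while 1/q = 2(α−2δ) is the decay exponent of the
  -- criterion; q ≤ 1 is exactly δ ≤ α/2 − 1/4.
  set q : ℝ := (2 * ((α : ℝ) - 2 * δ))⁻¹ with hq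
  have hq0 : 0 < q := by positivity
  have hq1 : q ≤ 1 := inv_le_one_of_one_le₀ (by linarith)
  have hbq : 2 * α * q = (α : ℝ) / ((α : ℝ) - 2 * δ) := by
    rw [hq]
    field_simp
  have hb : 1 < (α : ℝ) / ((α : ℝ) - 2 * δ) := by
    rw [one_lt_div hpos]
    linarith
  have h1 := dualSum_rpow_le hα hN hz hq0 hq1 (hbq ▸ hb)
  rw [hbq] at h1
  have h2 := h1.trans (ENNReal.ofReal_le_ofReal
    (averaging_bound_le hd hN.two_le hb (omega_nonneg _)))
  rw [mul_div_assoc 2 (α : ℝ)]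
  set Y := max 6 (5 / 2 + (2 : ℝ) ^ (2 * ((α : ℝ) / ((α : ℝ) - 2 * δ)) + 1)) *
    subsetSum d (omega ((α : ℝ) / ((α : ℝ) - 2 * δ))) ^ 2 / N with hY
  have hY0 : 0 ≤ Y := by
    have : (0 : ℝ) ≤ max 6 (5 / 2 + (2 : ℝ) ^ (2 * ((α : ℝ) / ((α : ℝ) - 2 * δ)) + 1)) :=
      le_trans (by norm_num) (le_max_left _ _)
    positivity
  rw [← ENNReal.le_rpow_inv_iff hq0, ENNReal.ofReal_rpow_of_nonneg hY0 (by positivity)] at h2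
  rw [← Real.rpow_natCast (Y ^ ((α : ℝ) - 2 * δ)), ← Real.rpow_mul hY0]
  convert h2 using 3
  rw [hq, inv_inv]
  push_cast
  ring

/-! ### The L² error bound -/

lemma eLpNorm_two_le {d : ℕ} {a : ℝ} {g : Box a d → ℝ} (hg : Continuous g) {c : ℝ} (hc : 0 ≤ c)
    (h : ∫ x, g x ^ 2 ≤ c ^ 2) : eLpNorm g 2 volume ≤ ENNReal.ofReal c := by
  have hm : MemLp g 2 (volume : Measure (Box a d)) :=
    (memLp_two_iff_integrable_sq hg.aestronglyMeasurable).2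
      (integrable_of_continuous (hg.pow 2))
  rw [hm.eLpNorm_eq_integral_rpow_norm two_ne_zero ENNReal.ofNat_ne_top]
  refine ENNReal.ofReal_le_ofReal ?_
  simp only [ENNReal.toReal_ofNat, Real.rpow_two, Real.norm_eq_abs, sq_abs]
  rw [← one_div, ← Real.sqrt_eq_rpow]
  exact Real.sqrt_le_iff.2 ⟨hc, h⟩

/-- The `L²` error bound for functions of the Korobov space vanishing on the lattice points. -/
lemma eLpNorm_le_of_vanishing {d α N : ℕ} (hα : 1 ≤ α) (hd : 1 ≤ d) (hN : N.Prime)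
    {z : Fin d → ℕ} (hz : IsCBCVector α N z) {a : ℝ} (ha : 1 / 2 ≤ a) (ha0 : 0 < a)
    (g : KorobovSpace α a d) (h0 : ∀ k, g (scaledLattice a ha0.le N z k) = 0)
    {δ : ℝ} (hδ : 0 < δ) (hδ' : δ ≤ (α : ℝ) / 2 - 1 / 4) :
    eLpNorm g 2 volume ≤ ENNReal.ofReal (errorConst α δ d * ‖g‖ * (2 * a) ^ (α * d) *
      (N : ℝ) ^ (-((α : ℝ) / 2 - δ))) := by
  have hpos : 0 < (α : ℝ) - 2 * δ := by linarith
  have hS := dualSum_le hα hd hN hz hδ hδ'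
  set K : ℝ := max 6 (5 / 2 + (2 : ℝ) ^ (2 * (α : ℝ) / ((α : ℝ) - 2 * δ) + 1)) with hK
  have hK0 : 0 < K := lt_of_lt_of_le (by norm_num) (le_max_left _ _)
  set Q := subsetSum d (omega ((α : ℝ) / ((α : ℝ) - 2 * δ))) with hQ
  have hQ0 : 0 < Q := by
    have hw := omega_nonneg ((α : ℝ) / ((α : ℝ) - 2 * δ))
    exact lt_of_lt_of_le (by positivity) (pow_le_subsetSum d hw)
  have hN0 : (0 : ℝ) < N := by exact_mod_cast hN.pos
  have hE : errorConst α δ d = Real.sqrt 2 * K ^ ((α : ℝ) / 2 - δ) * Q ^ ((α : ℝ) - 2 * δ) := rfl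
  obtain ⟨hs, hG⟩ := sum_norm_coeff_sq_weight_half_le ha g
  have hY : 0 < K * Q ^ 2 / N := by positivity
  have h1 := integral_sq_le hα hN.ne_zero ha0 z g.2.1 h0 hs (Real.rpow_pos_of_pos hY _) hS
  -- Since α − 2δ = 2(α/2 − δ), the bound R is a perfect square, and its root carries the rate
  -- N^{-(α/2−δ)}. The factor 2 in 2RG becomes the √2 of the constant.
  have hfac : (K * Q ^ 2 / N) ^ ((α : ℝ) - 2 * δ) =
      (K ^ ((α : ℝ) / 2 - δ) * Q ^ ((α : ℝ) - 2 * δ) * (N : ℝ) ^ (-((α : ℝ) / 2 - δ))) ^ 2 := by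
    have h2 : (α : ℝ) - 2 * δ = ((α : ℝ) / 2 - δ) * (2 : ℕ) := by push_cast; ring
    have h3 : Q ^ ((α : ℝ) - 2 * δ) = (Q ^ 2) ^ ((α : ℝ) / 2 - δ) := by
      rw [← Real.rpow_natCast Q 2, ← Real.rpow_mul hQ0.le, h2, mul_comm]
    rw [h3, Real.rpow_neg hN0.le, ← Real.inv_rpow hN0.le, ← Real.mul_rpow hK0.le (by positivity),
      ← Real.mul_rpow (by positivity) (by positivity), ← div_eq_mul_inv, h2,
      Real.rpow_mul hY.le, Real.rpow_natCast]
  refine eLpNorm_two_le (HasFourierSeries.continuous g.2.1) (by rw [hE]; positivity) ?_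
  refine h1.trans ((mul_le_mul_of_nonneg_left hG (by positivity)).trans_eq ?_)
  rw [hfac, hE]
  simp only [mul_pow, Real.sq_sqrt zero_le_two]
  ring

end Korobov

end

theorem proposition3p5 (α d N : ℕ) (hα : 1 ≤ α) (hd : 1 ≤ d) (hN : N.Prime) :
    (∃ z : Fin d → ℕ, Korobov.IsCBCVector α N z) ∧
    ∀ z : Fin d → ℕ, Korobov.IsCBCVector α N z →
      ∀ (a : ℝ) (ha : 1 / 2 ≤ a) (φ : Korobov.KorobovSpace α a d),
        -- the projection is the unique kernel interpolant of `φ` at the scaled lattice points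
        (∀ v ∈ Korobov.kernelSpan α (Korobov.scaledLattice a (by linarith) N z),
          (∀ k, v (Korobov.scaledLattice a (by linarith) N z k) =
            φ (Korobov.scaledLattice a (by linarith) N z k)) ↔
          v = Korobov.proj α (Korobov.scaledLattice a (by linarith) N z) φ) ∧
        -- the error bound
        ∀ δ : ℝ, 0 < δ → δ < (α : ℝ) / 2 →
          MeasureTheory.eLpNorm
              (fun x => Korobov.proj α (Korobov.scaledLattice a (by linarith) N z) φ x - φ x)
              2 MeasureTheory.volume ≤
            ENNReal.ofReal
              (Korobov.errorConst α (min δ ((α : ℝ) / 2 - 1 / 4)) d * ‖φ‖ *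
                (2 * a) ^ (α * d) * (N : ℝ) ^ (-((α : ℝ) / 2 - δ))) := by
  refine ⟨Korobov.exists_isCBCVector hN.two_le α d, fun z hz a ha φ => ⟨fun v hv =>
    Korobov.interpolates_iff_eq_proj hα ha _ φ hv, fun δ hδ _ => ?_⟩⟩
  have hα' : (1 : ℝ) ≤ α := by exact_mod_cast hα
  have ha0 : 0 < a := by linarith
  set X := Korobov.scaledLattice a ha0.le N z with hX
  -- The averaging argument is run at the capped δ'; it is positive because α ≥ 1.
  set δ' := min δ ((α : ℝ) / 2 - 1 / 4) with hδ'
  have h1 : 0 < δ' := lt_min hδ (by linarith)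
  have h2 := Korobov.eLpNorm_le_of_vanishing hα hd hN hz ha ha0 (φ - Korobov.proj α X φ)
    (Korobov.sub_proj_apply hα ha X φ) h1 (min_le_right _ _)
  have h3 : (fun x => Korobov.proj α X φ x - φ x) =
      -(Korobov.toFun (φ - Korobov.proj α X φ)) := by
    funext x
    simp
  rw [h3, MeasureTheory.eLpNorm_neg]
  refine h2.trans (ENNReal.ofReal_le_ofReal ?_)
  have hN1 : (1 : ℝ) ≤ N := by exact_mod_cast hN.one_lt.le
  have hC : 0 ≤ Korobov.errorConst α δ' d := Korobov.errorConst_nonneg α δ' d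
  -- As δ' ≤ δ and N ≥ 1, the rate obtained at δ' is at least as good as the one claimed at δ.
  gcongr
  · exact Korobov.norm_sub_proj_le X φ
  · exact min_le_left _ _
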